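/- Let $G$ be a finite-dimensional real Lie group with identity $e$, Lie algebra $\mathfrak g$ and dual $\mathfrak g^*$, and let $\tau$ be a smooth diffeomorphism (for instance an analytic one) from an open neighbourhood $\mathcal U=-\mathcal U$ of $0\in\mathfrak g$ onto an open neighbourhood of $e\in G$, with $\tau(0)=e$ and $\tau(\xi)\tau(-\xi)=e$. Let $d\tau_\xi\delta = TR_{\tau(\xi)^{-1}}(D\tau(\xi)\delta)$ be its right-trivialized tangent, $d\tau_\xi^{-1}\delta=D\tau^{-1}(\tau(\xi))(TR_{\tau(\xi)}\delta)$ the inverse one, and let ${}^*$ denote dual maps on $\mathfrak g^*$. Let $\ell:G\times\mathfrak g\to\mathbb R$ be smooth and let $g\frac{\partial\ell}{\partial g}\in\mathfrak g^*$ be given by $\langle g\frac{\partial\ell}{\partial g},\eta\rangle=\langle\frac{\partial\ell}{\partial g},TL_g\eta\rangle$. Let $a_{ij},b_i\in\mathbb R$ $(i,j=1,\dots,s)$ with all $b_i\ne0$, let $h>0$, and let $N\ge1$. For $g_1,g_2\in G$ let $\mathcal C_d(g_1,g_2)$ be the set of discrete curves $c_d=(g_k,\mu_k,\{\Theta_k^i,\Xi_k^i,\mu_k^i\}_{i=1}^s)_{k=0}^N$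 in $(G\times\mathfrak g^*)\times(\mathfrak g\times\mathfrak g\times\mathfrak g^*)^s$ with $g_0=g_1$ and $g_N=g_2$ as prescribed endpoints. Put $G_k^i=g_k\tau(h\Theta_k^i)$ and $$s_d=\sum_{k=0}^{N-1}\Big(\sum_{i=1}^s h\Big[b_i\,\ell(G_k^i,\Xi_k^i)+\Big\langle\mu_k^i,\tfrac1h\tau^{-1}(g_k^{-1}G_k^i)-\sum_{j}a_{ij}\Xi_k^j\Big\rangle\Big]+h\Big\langle\mu_{k+1},\tfrac1h\tau^{-1}(g_k^{-1}g_{k+1})-\sum_j b_j\Xi_k^j\Big\rangle\Big).$$ With $f_k^j=(d\tau_{-h\Theta_k^j})^*\,G_k^j\frac{\partial\ell}{\partial g}(G_k^j,\Xi_k^j)$, the VPRK scheme consists of the equations, for $i=1,\dots,s$ and $k=0,\dots,N-1$, $$\tfrac1h\tau^{-1}(g_k^{-1}G_k^i)=\sum_j a_{ij}\Xi_k^j=\Theta_k^i,\qquad \tfrac1h\tau^{-1}(g_k^{-1}g_{k+1})=\sum_j b_j\Xi_k^j=\xi_{k+1},$$ $$(d\tau^{-1}_{h\xi_{k+1}})^*M_k^i=(d\tau^{-1}_{-h\xi_k})^*\mu_k+h\sum_j\Big(b_j(d\tau^{-1}_{h\Theta_k^j})^*-\tfrac{b_ja_{ji}}{b_i}(d\tau^{-1}_{h\xi_{k+1}})^*\Big)f_k^j,$$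 $$(d\tau^{-1}_{h\xi_{k+1}})^*\mu_{k+1}=(d\tau^{-1}_{-h\xi_k})^*\mu_k+h\sum_j b_j(d\tau^{-1}_{h\Theta_k^j})^*f_k^j,\qquad M_k^i=\frac{\partial\ell}{\partial\xi}(G_k^i,\Xi_k^i).$$ The initial velocity $\xi_0$ is any vector with $h\xi_0\in\mathcal U$. (1) Let $c_d\in\mathcal C_d(g_1,g_2)$ satisfy $h\Theta_k^i\in\mathcal U$ and $g_k^{-1}g_{k+1}\in\tau(\mathcal U)$ for $0\le k<N$, $1\le i\le s$, and let $h\xi_0\in\mathcal U$. Then $c_d$ is a critical point of $s_d:\mathcal C_d(g_1,g_2)\to\mathbb R$, i.e. $\mathbf ds_d(c_d)=0$, if and only if it satisfies the VPRK scheme, where the internal multipliers, which do not appear in the scheme, have the values $\mu_k^i=-h\,b_i\,f_k^i$ $(0\le k<N)$, and where $\mu_0$, on which $s_d$ does not depend, is assigned the unique value in $\mathfrak g^*$ for which the scheme holds (so the scheme is required to hold for exactly one choice of $\mu_0$). (2) Let $\mathcal I_{hp}=\{(g,\xi,\mu)\in G\times\mathfrak g\times\mathfrak g^*\mid\mu=\frac{\partial\ell}{\partial\xi}(g,\xi)\}$,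 and let $\omega_{\mathcal I_{hp}}$ be the pullback to $\mathcal I_{hp}$, under $(g,\xi,\mu)\mapsto(g,\mu)\in G\times\mathfrak g^*\cong T^*G$, of the canonical form $-\mathbf d\Theta$, $\Theta_{(g,\mu)}(\delta g,\delta\mu)=\langle\mu,g^{-1}\delta g\rangle$. A solution of the scheme has at time $t_k$ the momentum $p_k=(d\tau^{-1}_{-h\xi_k})^*\mu_k$, and is represented there by a point of $\mathcal I_{hp}$ lying over $(g_k,p_k)$. Let $F_h:\mathcal I_{hp}\to\mathcal I_{hp}$ be a discrete flow map defined by the scheme on an open set $U\subset\mathcal I_{hp}$: $F_h$ is smooth on $U$, and for each $z\in U$ lying over $(g,p)$ there is a solution of the one-step scheme $(N=1)$ with $h\xi_0$, $h\Theta_0^i\in\mathcal U$, $g_0^{-1}g_1\in\tau(\mathcal U)$, with stages $\Xi_0^i$ depending smoothly on $z$, such that $(g_0,p_0)=(g,p)$ and $F_h(z)$ lies over $(g_1,p_1)$. Then $F_h$ preserves $\omega_{\mathcal I_{hp}}$ on $U$: $(F_h^*\omega_{\mathcal I_{hp}})_z=(\omega_{\mathcal I_{hp}})_z$ for all $z\in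 U$. -/

import Mathlib

open Set Filter Topology
open scoped Manifold ContDiff

noncomputable section

namespace LieVPRK

/-! ### Exterior derivative of a one-form on a (boundaryless) manifold -/

section ExteriorDerivative

variable {F : Type*} [NormedAddCommGroup F] [NormedSpace ℝ F]
  {H : Type*} [TopologicalSpace H] (I : ModelWithCorners ℝ F H)
  {M : Type*} [TopologicalSpace M] [ChartedSpace H M]

/-- The local expression `(φ⁻¹)^* α` of a one-form `α` in the preferred chart `φ` around `x₀`. -/
def oneFormInChart (α : ∀ x : M, TangentSpace I x →L[ℝ] ℝ) (x₀ : M) : F → (F →L[ℝ] ℝ) :=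
  fun y => (α ((extChartAt I x₀).symm y)).comp (mfderiv 𝓘(ℝ, F) I (extChartAt I x₀).symm y)

/-- The exterior derivative `(dα)_{x₀}(v, w)` of a one-form `α`: if `A` is the local expression of
`α` in a chart, then `dα (v, w) = (DA v) w - (DA w) v` in that chart. -/
def dOneForm (α : ∀ x : M, TangentSpace I x →L[ℝ] ℝ) (x₀ : M) (v w : TangentSpace I x₀) : ℝ :=
  let φ := extChartAt I x₀
  let A := oneFormInChart I α x₀
  let v' : F := mfderiv I 𝓘(ℝ, F) φ x₀ v
  let w' : F := mfderiv I 𝓘(ℝ, F) φ x₀ w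
  fderiv ℝ A (φ x₀) v' w' - fderiv ℝ A (φ x₀) w' v'

end ExteriorDerivative

/-! In what follows `G` is a Lie group modelled on `E`. The Lie algebra `𝔤 = T_e G` is by
definition (of the tangent space) the vector space `E`; its dual `𝔤*` is `E →L[ℝ] ℝ`. -/

section Group

variable {E : Type*} [NormedAddCommGroup E] [NormedSpace ℝ E]
  {G : Type*} [TopologicalSpace G] [ChartedSpace E G] [Group G]

/-! ### The local chart `τ : 𝔤 → G` -/

/-- `τ` is a diffeomorphism of a neighbourhood of `0 ∈ 𝔤` (its source) onto a neighbourhood of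
`e ∈ G` (its target) with `τ 0 = e` and `τ ξ * τ (-ξ) = e`. -/
structure IsCanonicalChart (τ : OpenPartialHomeomorph E G) : Prop where
  zero_mem : (0 : E) ∈ τ.source
  map_zero : τ 0 = 1
  neg_mem : ∀ ξ ∈ τ.source, -ξ ∈ τ.source
  mul_neg : ∀ ξ ∈ τ.source, τ ξ * τ (-ξ) = 1
  smooth : ContMDiffOn 𝓘(ℝ, E) 𝓘(ℝ, E) ∞ τ τ.source
  smooth_symm : ContMDiffOn 𝓘(ℝ, E) 𝓘(ℝ, E) ∞ τ.symm τ.target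

/-- The right-trivialized tangent `dτ_ξ δ = TR_{τ(ξ)⁻¹} (Dτ(ξ) δ) ∈ T_e G`. -/
def dtau (τ : OpenPartialHomeomorph E G) (ξ : E) : E →L[ℝ] E :=
  mfderiv 𝓘(ℝ, E) 𝓘(ℝ, E) (fun y => τ y * (τ ξ)⁻¹) ξ

/-- The inverse right-trivialized tangent `dτ⁻¹_ξ δ = Dτ⁻¹(τ(ξ)) (TR_{τ(ξ)} δ)`. -/
def dtauInv (τ : OpenPartialHomeomorph E G) (ξ : E) : E →L[ℝ] E :=
  mfderiv 𝓘(ℝ, E) 𝓘(ℝ, E) (fun x : G => τ.symm (x * τ ξ)) 1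

/-- The dual `A^* : 𝔤* → 𝔤*` of a linear map `A : 𝔤 → 𝔤`. -/
def dual (A : E →L[ℝ] E) (μ : E →L[ℝ] ℝ) : E →L[ℝ] ℝ := μ.comp A

/-! ### Derivatives of the left-trivialized Lagrangian -/

/-- `∂ℓ/∂ξ (g, ξ) ∈ 𝔤*`. -/
def dXi (ℓ : G × E → ℝ) (g : G) (ξ : E) : E →L[ℝ] ℝ :=
  fderiv ℝ (fun ζ => ℓ (g, ζ)) ξ

/-- `g ∂ℓ/∂g (g, ξ) ∈ 𝔤*`, the left translation of `∂ℓ/∂g (g, ξ) ∈ T_g^* G` to the identity: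
`⟨g ∂ℓ/∂g, η⟩ = ⟨∂ℓ/∂g, TL_g η⟩`. -/
def gdG (ℓ : G × E → ℝ) (g : G) (ξ : E) : E →L[ℝ] ℝ :=
  mfderiv 𝓘(ℝ, E) 𝓘(ℝ, ℝ) (fun x : G => ℓ (g * x, ξ)) 1

/-! ### Discrete curves and the action sum -/

/-- A discrete curve `(g, μ, {Θ^i, Ξ^i, μ^i}_{i=1}^s) : {t_0, …, t_N} → (G × 𝔤*) × (𝔤 × 𝔤 × 𝔤*)^s`. -/
@[ext] structure DiscreteCurve (E : Type*) [NormedAddCommGroup E] [NormedSpace ℝ E]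
    (G : Type*) (N s : ℕ) where
  g : Fin (N + 1) → G
  mu : Fin (N + 1) → (E →L[ℝ] ℝ)
  Theta : Fin (N + 1) → Fin s → E
  Xi : Fin (N + 1) → Fin s → E
  muStage : Fin (N + 1) → Fin s → (E →L[ℝ] ℝ)

namespace DiscreteCurve

variable {N s : ℕ}

/-- The internal stage configuration `G_k^i = g_k τ(h Θ_k^i)`. -/
def stageG (τ : OpenPartialHomeomorph E G) (h : ℝ) (c : DiscreteCurve E G N s)
    (k : Fin N) (i : Fin s) : G :=
  c.g k.castSucc * τ (h • c.Theta k.castSucc i)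

/-- The curve stays where the chart `τ` can be used: `h Θ_k^i` lies in the domain of `τ`, and
`g_k⁻¹ g_{k+1}` in the domain of `τ⁻¹`. -/
def InChart (τ : OpenPartialHomeomorph E G) (h : ℝ) (c : DiscreteCurve E G N s) : Prop :=
  ∀ k : Fin N, (c.g k.castSucc)⁻¹ * c.g k.succ ∈ τ.target ∧
    ∀ i, h • c.Theta k.castSucc i ∈ τ.source

/-- The same curve with `μ_0` replaced by `ν`. -/
def withMuZero (c : DiscreteCurve E G N s) (ν : E →L[ℝ] ℝ) : DiscreteCurve E G N s :=
  { c with mu := Function.update c.mu 0 ν }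

/-- The path space `C_d(g₁, g₂)`. -/
def pathSpace (E : Type*) [NormedAddCommGroup E] [NormedSpace ℝ E] {G : Type*} (N s : ℕ)
    (g₁ g₂ : G) : Set (DiscreteCurve E G N s) :=
  {c | c.g 0 = g₁ ∧ c.g (Fin.last N) = g₂}

/-- The discrete Hamilton-Pontryagin action sum `s_d`. -/
def actionSum (τ : OpenPartialHomeomorph E G) (a : Fin s → Fin s → ℝ) (b : Fin s → ℝ) (h : ℝ)
    (ℓ : G × E → ℝ) (c : DiscreteCurve E G N s) : ℝ :=
  ∑ k : Fin N,
    ((∑ i : Fin s, h * (b i * ℓ (c.stageG τ h k i, c.Xi k.castSucc i)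
        + c.muStage k.castSucc i
            (h⁻¹ • τ.symm ((c.g k.castSucc)⁻¹ * c.stageG τ h k i)
              - ∑ j, a i j • c.Xi k.castSucc j)))
      + h * c.mu k.succ
          (h⁻¹ • τ.symm ((c.g k.castSucc)⁻¹ * c.g k.succ) - ∑ j, b j • c.Xi k.castSucc j))

/-- A smooth variation of `c₀` inside `C_d(g₁, g₂)`: all variables vary arbitrarily and
independently, except for the fixed endpoints. -/
structure IsVariation (g₁ g₂ : G) (c₀ : DiscreteCurve E G N s)
    (c : ℝ → DiscreteCurve E G N s) : Prop where
  at_zero : c 0 = c₀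
  mem : ∀ ε, c ε ∈ pathSpace E N s g₁ g₂
  smooth_g : ∀ k, ContMDiffAt 𝓘(ℝ, ℝ) 𝓘(ℝ, E) ∞ (fun ε => (c ε).g k) 0
  smooth_mu : ∀ k, ContDiffAt ℝ ∞ (fun ε => (c ε).mu k) 0
  smooth_Theta : ∀ k i, ContDiffAt ℝ ∞ (fun ε => (c ε).Theta k i) 0
  smooth_Xi : ∀ k i, ContDiffAt ℝ ∞ (fun ε => (c ε).Xi k i) 0
  smooth_muStage : ∀ k i, ContDiffAt ℝ ∞ (fun ε => (c ε).muStage k i) 0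

/-- `c₀` is a critical point of `s_d : C_d(g₁, g₂) → ℝ`, i.e. `d s_d (c₀) = 0`: the derivative of
`s_d` along every smooth variation of `c₀` in `C_d(g₁, g₂)` exists and vanishes. -/
def IsCritical (τ : OpenPartialHomeomorph E G) (a : Fin s → Fin s → ℝ) (b : Fin s → ℝ) (h : ℝ)
    (ℓ : G × E → ℝ) (g₁ g₂ : G) (c₀ : DiscreteCurve E G N s) : Prop :=
  ∀ c : ℝ → DiscreteCurve E G N s, IsVariation g₁ g₂ c₀ c →
    HasDerivAt (fun ε => actionSum τ a b h ℓ (c ε)) 0 0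

/-- The left-trivialized momentum `(dτ⁻¹_{-h ξ_k})^* μ_k` at time `t_k`. -/
def momentum (τ : OpenPartialHomeomorph E G) (h : ℝ) (c : DiscreteCurve E G N s)
    (ξ : Fin (N + 1) → E) (k : Fin (N + 1)) : E →L[ℝ] ℝ :=
  dual (dtauInv τ (-(h • ξ k))) (c.mu k)

/-- The stage force `(dτ_{-h Θ_k^j})^* G_k^j ∂ℓ/∂g (G_k^j, Ξ_k^j)`. -/
def force (τ : OpenPartialHomeomorph E G) (h : ℝ) (ℓ : G × E → ℝ) (c : DiscreteCurve E G N s)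
    (k : Fin N) (j : Fin s) : E →L[ℝ] ℝ :=
  dual (dtau τ (-(h • c.Theta k.castSucc j))) (gdG ℓ (c.stageG τ h k j) (c.Xi k.castSucc j))

/-- The VPRK scheme for the discrete curve `c`, with velocities `ξ_0, …, ξ_N` and stage momenta
`M_k^i`. -/
structure IsVPRK (τ : OpenPartialHomeomorph E G) (a : Fin s → Fin s → ℝ) (b : Fin s → ℝ) (h : ℝ)
    (ℓ : G × E → ℝ) (c : DiscreteCurve E G N s) (ξ : Fin (N + 1) → E)
    (M : Fin N → Fin s → (E →L[ℝ] ℝ)) : Prop where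
  internal : ∀ k i,
    h⁻¹ • τ.symm ((c.g k.castSucc)⁻¹ * c.stageG τ h k i) = ∑ j, a i j • c.Xi k.castSucc j ∧
      ∑ j, a i j • c.Xi k.castSucc j = c.Theta k.castSucc i
  external : ∀ k : Fin N,
    h⁻¹ • τ.symm ((c.g k.castSucc)⁻¹ * c.g k.succ) = ∑ j, b j • c.Xi k.castSucc j ∧
      ∑ j, b j • c.Xi k.castSucc j = ξ k.succ
  stageMomentum : ∀ k i,
    dual (dtauInv τ (h • ξ k.succ)) (M k i) = c.momentum τ h ξ k.castSucc
      + h • ∑ j, (b j • dual (dtauInv τ (h • c.Theta k.castSucc j)) (c.force τ h ℓ k j)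
          - (b j * a j i / b i) • dual (dtauInv τ (h • ξ k.succ)) (c.force τ h ℓ k j))
  externalMomentum : ∀ k : Fin N,
    dual (dtauInv τ (h • ξ k.succ)) (c.mu k.succ) = c.momentum τ h ξ k.castSucc
      + h • ∑ j, b j • dual (dtauInv τ (h • c.Theta k.castSucc j)) (c.force τ h ℓ k j)
  legendre : ∀ k i, M k i = dXi ℓ (c.stageG τ h k i) (c.Xi k.castSucc i)

/-- `c` satisfies the VPRK scheme with initial velocity `ξ_0`. The quantities `ξ_1, …, ξ_N` and
`M_k^i` are determined by the scheme. -/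
def SatisfiesVPRK (τ : OpenPartialHomeomorph E G) (a : Fin s → Fin s → ℝ) (b : Fin s → ℝ) (h : ℝ)
    (ℓ : G × E → ℝ) (ξ₀ : E) (c : DiscreteCurve E G N s) : Prop :=
  ∃ (ξ : Fin (N + 1) → E) (M : Fin N → Fin s → (E →L[ℝ] ℝ)),
    ξ 0 = ξ₀ ∧ IsVPRK τ a b h ℓ c ξ M

end DiscreteCurve

/-! ### The admissible space and its symplectic form -/

/-- The admissible space `I_hp = {(g, ξ, μ) ∈ G × 𝔤 × 𝔤* | μ = ∂ℓ/∂ξ (g, ξ)}`. -/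
def admissibleSpace (ℓ : G × E → ℝ) : Set (G × E × (E →L[ℝ] ℝ)) :=
  {z | z.2.2 = dXi ℓ z.1 z.2.1}

/-- `I_hp` is the graph of `∂ℓ/∂ξ`; as a manifold it is identified with `G × 𝔤` through the graph
chart `(g, ξ, μ) ↦ (g, ξ)`. -/
def graphChart (ℓ : G × E → ℝ) : admissibleSpace ℓ ≃ G × E where
  toFun z := (z.1.1, z.1.2.1)
  invFun x := ⟨(x.1, x.2, dXi ℓ x.1 x.2), rfl⟩
  left_inv := by
    rintro ⟨⟨g, ξ, μ⟩, hz⟩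
    have hμ : μ = dXi ℓ g ξ := hz
    subst hμ
    rfl
  right_inv _ := rfl

/-- The projection `I_hp → T^* G ≅ G × 𝔤*`, `(g, ξ, μ) ↦ (g, μ)`, in the graph chart (that is, the
left-trivialized Legendre transform). -/
def projHp (ℓ : G × E → ℝ) (x : G × E) : G × (E →L[ℝ] ℝ) := (x.1, dXi ℓ x.1 x.2)

/-- The canonical one-form of `T^* G` in the left trivialization `G × 𝔤*`:
`Θ_{(g, μ)} (δg, δμ) = ⟨μ, g⁻¹ δg⟩`. -/
def canonicalOneForm (x : G × (E →L[ℝ] ℝ)) :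
    TangentSpace (𝓘(ℝ, E).prod 𝓘(ℝ, E →L[ℝ] ℝ)) x →L[ℝ] ℝ :=
  x.2.comp ((mfderiv 𝓘(ℝ, E) 𝓘(ℝ, E) (fun y : G => x.1⁻¹ * y) x.1).comp
    (mfderiv (𝓘(ℝ, E).prod 𝓘(ℝ, E →L[ℝ] ℝ)) 𝓘(ℝ, E) Prod.fst x))

/-- The canonical symplectic form `Ω = -dΘ` of `T^* G` in the left trivialization. -/
def canonicalTwoForm (x : G × (E →L[ℝ] ℝ))
    (v w : TangentSpace (𝓘(ℝ, E).prod 𝓘(ℝ, E →L[ℝ] ℝ)) x) : ℝ :=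
  -dOneForm (𝓘(ℝ, E).prod 𝓘(ℝ, E →L[ℝ] ℝ)) canonicalOneForm x v w

/-- The form `ω_{I_hp}`, the pullback of `Ω` to `I_hp`, in the graph chart. -/
def omegaHp (ℓ : G × E → ℝ) (x : G × E) (v w : TangentSpace (𝓘(ℝ, E).prod 𝓘(ℝ, E)) x) : ℝ :=
  let D := mfderiv (𝓘(ℝ, E).prod 𝓘(ℝ, E)) (𝓘(ℝ, E).prod 𝓘(ℝ, E →L[ℝ] ℝ)) (projHp ℓ) x
  canonicalTwoForm (projHp ℓ x) (D v) (D w)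

/-- A self-map of `I_hp` in the graph chart. -/
def inGraphChart (ℓ : G × E → ℝ) (F : admissibleSpace ℓ → admissibleSpace ℓ) : G × E → G × E :=
  fun x => graphChart ℓ (F ((graphChart ℓ).symm x))

/-- `F` preserves `ω_{I_hp}` at the points of `U`: `(F^* ω)_z (v, w) = ω_z (v, w)`. -/
def PreservesOmegaHp (ℓ : G × E → ℝ) (U : Set (admissibleSpace ℓ))
    (F : admissibleSpace ℓ → admissibleSpace ℓ) : Prop :=
  ∀ x : G × E, (graphChart ℓ).symm x ∈ U →
    ∀ v w : TangentSpace (𝓘(ℝ, E).prod 𝓘(ℝ, E)) x,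
      let D := mfderiv (𝓘(ℝ, E).prod 𝓘(ℝ, E)) (𝓘(ℝ, E).prod 𝓘(ℝ, E)) (inGraphChart ℓ F) x
      omegaHp ℓ (inGraphChart ℓ F x) (D v) (D w) = omegaHp ℓ x v w

/-! ### The discrete flow map -/

/-- `F` is a smooth discrete flow map `F_h : I_hp → I_hp` of the VPRK scheme on the open set `U`:
for every `z = (g, ·, p) ∈ U` there is a one-step solution of the scheme, whose stages depend
smoothly on `z`, that leads from `g_0 = g` with momentum `(dτ⁻¹_{-h ξ_0})^* μ_0 = p` to the base
point `g_1 = g'` and the momentum `(dτ⁻¹_{-h ξ_1})^* μ_1 = p'` of `F z = (g', ·, p')`. -/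
structure IsDiscreteFlow {s : ℕ} (τ : OpenPartialHomeomorph E G) (a : Fin s → Fin s → ℝ)
    (b : Fin s → ℝ) (h : ℝ) (ℓ : G × E → ℝ) (U : Set (admissibleSpace ℓ))
    (F : admissibleSpace ℓ → admissibleSpace ℓ) : Prop where
  smooth : ContMDiffOn (𝓘(ℝ, E).prod 𝓘(ℝ, E)) (𝓘(ℝ, E).prod 𝓘(ℝ, E)) ∞ (inGraphChart ℓ F)
    ((graphChart ℓ).symm ⁻¹' U)
  scheme : ∃ (c : admissibleSpace ℓ → DiscreteCurve E G 1 s) (ξ : admissibleSpace ℓ → Fin 2 → E)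
    (M : admissibleSpace ℓ → Fin 1 → Fin s → (E →L[ℝ] ℝ)),
    (∀ i, ContMDiffOn (𝓘(ℝ, E).prod 𝓘(ℝ, E)) 𝓘(ℝ, E) ∞
      (fun x => (c ((graphChart ℓ).symm x)).Xi 0 i) ((graphChart ℓ).symm ⁻¹' U)) ∧
    ∀ z ∈ U,
      (c z).InChart τ h ∧ h • ξ z 0 ∈ τ.source ∧
      (c z).IsVPRK τ a b h ℓ (ξ z) (M z) ∧
      (c z).g 0 = z.1.1 ∧ (c z).momentum τ h (ξ z) 0 = z.1.2.2 ∧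
      (c z).g 1 = (F z).1.1 ∧ (c z).momentum τ h (ξ z) 1 = (F z).1.2.2

end Group

end LieVPRK

end

/-!
The derivative of `τ⁻¹ (g⁻¹ k)` in left-trivialized variations of `g` and `k` is expressed through
`dτ⁻¹` at `± τ⁻¹ (g⁻¹ k)`, so the first variation of the action sum is a sum of pairings of
independent variations with coefficients, plus boundary terms at `g_0` and `g_N`. With fixed end
points its vanishing is the vanishing of all coefficients: the Hamilton–Pontryagin equations.
Stationarity in `Θ` determines the internal multipliers, `μ_k^i = -h b_i f_k^i`; the equations for
`g` and `Ξ` then become the momentum equations of the scheme, and as `dτ⁻¹` is invertible, the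
equation for `k = 0`, which is not a stationarity condition, just defines `μ_0`.

Along solutions the constraints hold, so the action sum reduces to the sum `S` of the Lagrangian
terms, and only the boundary terms of its variation survive: `dS = F_h^* Θ - Θ` for the canonical
one-form `Θ` on `I_hp`. Taking exterior derivatives shows that `F_h` preserves `ω = -dΘ`.
-/

noncomputable section

namespace LieVPRK

section ModelDerivative

variable {𝕜 : Type*} [NontriviallyNormedField 𝕜]
  {F : Type*} [NormedAddCommGroup F] [NormedSpace 𝕜 F]
  {H : Type*} [TopologicalSpace H] {I : ModelWithCorners 𝕜 F H}
  {X : Type*} [TopologicalSpace X] [ChartedSpace H X]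
  {F₁ : Type*} [NormedAddCommGroup F₁] [NormedSpace 𝕜 F₁]
  {H₁ : Type*} [TopologicalSpace H₁] {I₁ : ModelWithCorners 𝕜 F₁ H₁}
  {M₁ : Type*} [TopologicalSpace M₁] [ChartedSpace H₁ M₁]
  {F₂ : Type*} [NormedAddCommGroup F₂] [NormedSpace 𝕜 F₂]
  {H₂ : Type*} [TopologicalSpace H₂] {I₂ : ModelWithCorners 𝕜 F₂ H₂}
  {M₂ : Type*} [TopologicalSpace M₂] [ChartedSpace H₂ M₂]
  {F₃ : Type*} [NormedAddCommGroup F₃] [NormedSpace 𝕜 F₃]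
  {H₃ : Type*} [TopologicalSpace H₃] {I₃ : ModelWithCorners 𝕜 F₃ H₃}
  {M₃ : Type*} [TopologicalSpace M₃] [ChartedSpace H₃ M₃]

variable (I I₁) in
/-- `HasMFDerivAt` with the derivative given as a linear map of the model spaces. Tangent spaces at
different points of a Lie group thereby share one type, as the left- and right-trivialized
derivatives require. -/
def HasModelDerivAt (f : X → M₁) (x : X) (A : F →L[𝕜] F₁) : Prop :=
  HasMFDerivAt I I₁ f x A

theorem hasModelDerivAt_mfderiv {f : X → M₁} {x : X} (hf : MDifferentiableAt I I₁ f x) :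
    HasModelDerivAt I I₁ f x (mfderiv I I₁ f x) :=
  hf.hasMFDerivAt

theorem hasModelDerivAt_iff_hasFDerivAt {f : F → F₁} {x : F} {A : F →L[𝕜] F₁} :
    HasModelDerivAt 𝓘(𝕜, F) 𝓘(𝕜, F₁) f x A ↔ HasFDerivAt f A x :=
  hasMFDerivAt_iff_hasFDerivAt

theorem hasModelDerivAt_const (y : M₁) (x : X) : HasModelDerivAt I I₁ (fun _ : X => y) x 0 :=
  hasMFDerivAt_const y x

theorem hasModelDerivAt_id (x : X) :
    HasModelDerivAt I I (fun y : X => y) x (ContinuousLinearMap.id 𝕜 F) :=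
  hasMFDerivAt_id x

namespace HasModelDerivAt

variable {f : X → M₁} {x : X} {A A' : F →L[𝕜] F₁}

theorem mdifferentiableAt (hf : HasModelDerivAt I I₁ f x A) : MDifferentiableAt I I₁ f x :=
  HasMFDerivAt.mdifferentiableAt hf

theorem mfderiv_eq (hf : HasModelDerivAt I I₁ f x A) : mfderiv I I₁ f x = A :=
  HasMFDerivAt.mfderiv hf

theorem unique (hA : HasModelDerivAt I I₁ f x A) (hA' : HasModelDerivAt I I₁ f x A') : A = A' :=
  hasMFDerivAt_unique hA hA'

theorem congr_deriv (hf : HasModelDerivAt I I₁ f x A) (h : A = A') :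
    HasModelDerivAt I I₁ f x A' :=
  h ▸ hf

theorem congr_of_eventuallyEq {f' : X → M₁} (hf : HasModelDerivAt I I₁ f x A)
    (h : f' =ᶠ[𝓝 x] f) : HasModelDerivAt I I₁ f' x A :=
  HasMFDerivAt.congr_of_eventuallyEq hf h

theorem comp {g : M₁ → M₂} {y : M₁} {B : F₁ →L[𝕜] F₂} (hg : HasModelDerivAt I₁ I₂ g y B)
    (hf : HasModelDerivAt I I₁ f x A) (hy : f x = y) :
    HasModelDerivAt I I₂ (fun t => g (f t)) x (B.comp A) := by
  subst hy
  exact HasMFDerivAt.comp x hg hf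

theorem prodMk {g : X → M₂} {B : F →L[𝕜] F₂} (hf : HasModelDerivAt I I₁ f x A)
    (hg : HasModelDerivAt I I₂ g x B) :
    HasModelDerivAt I (I₁.prod I₂) (fun t => (f t, g t)) x (A.prod B) :=
  HasMFDerivAt.prodMk hf hg

theorem comp_prodMk {g : X → M₂} {q : M₁ × M₂ → M₃} {B : F →L[𝕜] F₂} {P : F₁ →L[𝕜] F₃}
    {Q : F₂ →L[𝕜] F₃} {y : M₁} {z : M₂} (hq : MDifferentiableAt (I₁.prod I₂) I₃ q (y, z))
    (hP : HasModelDerivAt I₁ I₃ (fun y' => q (y', z)) y P)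
    (hQ : HasModelDerivAt I₂ I₃ (fun z' => q (y, z')) z Q)
    (hf : HasModelDerivAt I I₁ f x A) (hg : HasModelDerivAt I I₂ g x B)
    (hy : f x = y) (hz : g x = z) :
    HasModelDerivAt I I₃ (fun t => q (f t, g t)) x (P.comp A + Q.comp B) := by
  refine ((hasModelDerivAt_mfderiv hq).comp (hf.prodMk hg) (by rw [hy, hz])).congr_deriv ?_
  ext t
  exact (mfderiv_prod_eq_add_apply (v := (A t, B t)) hq).trans
    (congrArg₂ (fun S T : F₃ => S + T) (congrArg (fun S : F₁ →L[𝕜] F₃ => S (A t)) hP.mfderiv_eq)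
      (congrArg (fun S : F₂ →L[𝕜] F₃ => S (B t)) hQ.mfderiv_eq))

end HasModelDerivAt

end ModelDerivative

section LeftDerivative

variable {𝕜 : Type*} [NontriviallyNormedField 𝕜]
  {F : Type*} [NormedAddCommGroup F] [NormedSpace 𝕜 F]
  {H : Type*} [TopologicalSpace H] {I : ModelWithCorners 𝕜 F H}
  {X : Type*} [TopologicalSpace X] [ChartedSpace H X]
  {E : Type*} [NormedAddCommGroup E] [NormedSpace 𝕜 E]
  {K : Type*} [TopologicalSpace K] {J : ModelWithCorners 𝕜 E K}
  {G : Type*} [TopologicalSpace G] [ChartedSpace K G] [Group G]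

variable (J) in
/-- The adjoint action `Ad_g = T_e (x ↦ g x g⁻¹)` of a Lie group on its Lie algebra, which is
identified with the model space. -/
def Ad (g : G) : E →L[𝕜] E := mfderiv J J (fun x : G => g * x * g⁻¹) 1

variable (I J) in
/-- `A` is the left-trivialized derivative `v ↦ g(x)⁻¹ Dg(x) v` of `g` at `x`, which takes its
values in the Lie algebra because `y ↦ g(x)⁻¹ g(y)` maps `x` to the identity. -/
def HasLeftDerivAt (g : X → G) (x : X) (A : F →L[𝕜] E) : Prop :=
  HasModelDerivAt I J (fun y => (g x)⁻¹ * g y) x A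

variable (I J) in
/-- The left-trivialized derivative `v ↦ g(x)⁻¹ Dg(x) v` of `g` at `x`, with junk value `0` where
`g` is not differentiable. -/
def leftDeriv (g : X → G) (x : X) : F →L[𝕜] E :=
  mfderiv I J (fun y => (g x)⁻¹ * g y) x

theorem HasLeftDerivAt.leftDeriv_eq {g : X → G} {x : X} {A : F →L[𝕜] E}
    (hg : HasLeftDerivAt I J g x A) : leftDeriv I J g x = A :=
  HasModelDerivAt.mfderiv_eq hg

theorem HasLeftDerivAt.congr_of_eventuallyEq {f g : X → G} {x : X} {A : F →L[𝕜] E}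
    (hg : HasLeftDerivAt I J g x A) (h : f =ᶠ[𝓝 x] g) : HasLeftDerivAt I J f x A :=
  HasModelDerivAt.congr_of_eventuallyEq hg
    (h.mono fun _ hy => congrArg₂ (fun p q : G => p⁻¹ * q) h.self_of_nhds hy)

theorem hasLeftDerivAt_const (g : G) (x : X) : HasLeftDerivAt I J (fun _ : X => g) x 0 :=
  hasModelDerivAt_const (g⁻¹ * g) x

theorem HasLeftDerivAt.comp {F₁ : Type*} [NormedAddCommGroup F₁] [NormedSpace 𝕜 F₁]
    {H₁ : Type*} [TopologicalSpace H₁] {I₁ : ModelWithCorners 𝕜 F₁ H₁}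
    {X₁ : Type*} [TopologicalSpace X₁] [ChartedSpace H₁ X₁] {f : X₁ → X} {g : X → G} {x : X₁}
    {A : F₁ →L[𝕜] F} {B : F →L[𝕜] E} (hg : HasLeftDerivAt I J g (f x) B)
    (hf : HasModelDerivAt I₁ I f x A) : HasLeftDerivAt I₁ J (fun y => g (f y)) x (B.comp A) :=
  HasModelDerivAt.comp (g := fun y => (g (f x))⁻¹ * g y) hg hf rfl

variable [LieGroup J 1 G] {g k u v : X → G} {x : X} {A B : F →L[𝕜] E}

theorem hasModelDerivAt_mul_of_eq_one (hu : HasModelDerivAt I J u x A)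
    (hv : HasModelDerivAt I J v x B) (hux : u x = 1) (hvx : v x = 1) :
    HasModelDerivAt I J (fun y => u y * v y) x (A + B) := by
  have h := HasModelDerivAt.comp_prodMk (q := fun p : G × G => p.1 * p.2)
    (P := .id 𝕜 E) (Q := .id 𝕜 E) ((contMDiff_mul J 1 _).mdifferentiableAt one_ne_zero)
    (by simpa only [mul_one] using hasModelDerivAt_id (I := J) (1 : G))
    (by simpa only [one_mul] using hasModelDerivAt_id (I := J) (1 : G)) hu hv hux hvx
  rwa [ContinuousLinearMap.id_comp, ContinuousLinearMap.id_comp] at h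

theorem hasModelDerivAt_inv_of_eq_one (hu : HasModelDerivAt I J u x A) (hux : u x = 1) :
    HasModelDerivAt I J (fun y => (u y)⁻¹) x (-A) := by
  have hinv : HasModelDerivAt I J (fun y => (u y)⁻¹) x _ := hasModelDerivAt_mfderiv
    (((contMDiff_inv J 1 _).mdifferentiableAt one_ne_zero).comp x hu.mdifferentiableAt)
  have hmul := hasModelDerivAt_mul_of_eq_one hu hinv hux (by rw [hux, inv_one])
  simp only [mul_inv_cancel] at hmul
  exact hinv.congr_deriv
    (eq_neg_of_add_eq_zero_right (hmul.unique (hasModelDerivAt_const (1 : G) x)))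

theorem hasModelDerivAt_conj (g : G) :
    HasModelDerivAt J J (fun x : G => g * x * g⁻¹) 1 (Ad J g) :=
  hasModelDerivAt_mfderiv
    (((contMDiff_mul_left (I := J) (n := 1) (a := g) 1).mul contMDiffAt_const).mdifferentiableAt
      one_ne_zero)

theorem hasLeftDerivAt_leftDeriv (hg : MDifferentiableAt I J g x) :
    HasLeftDerivAt I J g x (leftDeriv I J g x) :=
  hasModelDerivAt_mfderiv ((mdifferentiableAt_mul_left (I := J) (a := (g x)⁻¹)).comp x hg)

namespace HasLeftDerivAt

theorem mul (hg : HasLeftDerivAt I J g x A) (hk : HasLeftDerivAt I J k x B) :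
    HasLeftDerivAt I J (fun y => g y * k y) x ((Ad J (k x)⁻¹).comp A + B) := by
  refine (hasModelDerivAt_mul_of_eq_one ((hasModelDerivAt_conj (k x)⁻¹).comp hg
    (inv_mul_cancel _)) hk ?_ (inv_mul_cancel _)).congr_of_eventuallyEq (.of_forall fun y => ?_)
  · simp only [inv_mul_cancel, mul_one, mul_inv_cancel]
  · simp only [mul_inv_rev, inv_inv, mul_assoc, mul_inv_cancel_left]

theorem inv_mul (hg : HasLeftDerivAt I J g x A) (hk : HasLeftDerivAt I J k x B) :
    HasLeftDerivAt I J (fun y => (g y)⁻¹ * k y) x (B - (Ad J ((g x)⁻¹ * k x)⁻¹).comp A) := by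
  have hconj := (hasModelDerivAt_conj ((g x)⁻¹ * k x)⁻¹).comp
    (hasModelDerivAt_inv_of_eq_one hg (inv_mul_cancel _)) (inv_eq_one.2 (inv_mul_cancel _))
  refine ((hasModelDerivAt_mul_of_eq_one hconj hk ?_ (inv_mul_cancel _)).congr_of_eventuallyEq
    (.of_forall fun y => ?_)).congr_deriv ?_
  · simp only [inv_mul_cancel, inv_one, mul_one, mul_inv_cancel]
  · simp only [mul_inv_rev, inv_inv, mul_assoc, mul_inv_cancel_left]
  · rw [ContinuousLinearMap.comp_neg, neg_add_eq_sub]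

end HasLeftDerivAt

end LeftDerivative

section CanonicalChart

variable {E : Type*} [NormedAddCommGroup E] [NormedSpace ℝ E]
  {G : Type*} [TopologicalSpace G] [ChartedSpace E G] [Group G]
  {F : Type*} [NormedAddCommGroup F] [NormedSpace ℝ F]
  {H : Type*} [TopologicalSpace H] {I : ModelWithCorners ℝ F H}
  {X : Type*} [TopologicalSpace X] [ChartedSpace H X]
  {τ : OpenPartialHomeomorph E G}

theorem eventually_mul_mem_target [LieGroup 𝓘(ℝ, E) 1 G] {ξ : E} (hξ : ξ ∈ τ.source) :
    ∀ᶠ x : G in 𝓝 1, x * τ ξ ∈ τ.target :=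
  (mdifferentiableAt_mul_right (I := 𝓘(ℝ, E))).continuousAt.eventually_mem
    (τ.open_target.mem_nhds ((one_mul (τ ξ)).symm ▸ τ.map_source hξ))

namespace IsCanonicalChart

theorem map_neg (hτ : IsCanonicalChart τ) {ξ : E} (hξ : ξ ∈ τ.source) : τ (-ξ) = (τ ξ)⁻¹ :=
  (inv_eq_of_mul_eq_one_right (hτ.mul_neg ξ hξ)).symm

theorem symm_inv (hτ : IsCanonicalChart τ) {x : G} (hx : x ∈ τ.target) :
    τ.symm x⁻¹ = -τ.symm x := by
  have h := τ.left_inv (hτ.neg_mem _ (τ.map_target hx))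
  rwa [hτ.map_neg (τ.map_target hx), τ.right_inv hx] at h

theorem mdifferentiableAt (hτ : IsCanonicalChart τ) {ξ : E} (hξ : ξ ∈ τ.source) :
    MDifferentiableAt 𝓘(ℝ, E) 𝓘(ℝ, E) τ ξ :=
  (hτ.smooth.contMDiffAt (τ.open_source.mem_nhds hξ)).mdifferentiableAt (by simp)

theorem mdifferentiableAt_symm (hτ : IsCanonicalChart τ) {x : G} (hx : x ∈ τ.target) :
    MDifferentiableAt 𝓘(ℝ, E) 𝓘(ℝ, E) τ.symm x :=
  (hτ.smooth_symm.contMDiffAt (τ.open_target.mem_nhds hx)).mdifferentiableAt (by simp)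

variable [LieGroup 𝓘(ℝ, E) 1 G]

theorem hasModelDerivAt_dtau (hτ : IsCanonicalChart τ) {ξ : E} (hξ : ξ ∈ τ.source) :
    HasModelDerivAt 𝓘(ℝ, E) 𝓘(ℝ, E) (fun y => τ y * (τ ξ)⁻¹) ξ (dtau τ ξ) :=
  hasModelDerivAt_mfderiv
    ((mdifferentiableAt_mul_right (I := 𝓘(ℝ, E))).comp ξ (hτ.mdifferentiableAt hξ))

theorem hasModelDerivAt_dtauInv (hτ : IsCanonicalChart τ) {ξ : E} (hξ : ξ ∈ τ.source) :
    HasModelDerivAt 𝓘(ℝ, E) 𝓘(ℝ, E) (fun x : G => τ.symm (x * τ ξ)) 1 (dtauInv τ ξ) :=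
  hasModelDerivAt_mfderiv
    (MDifferentiableAt.comp_of_eq 1 (hτ.mdifferentiableAt_symm (τ.map_source hξ))
      (mdifferentiableAt_mul_right (I := 𝓘(ℝ, E))) (one_mul _))

/- Both left-trivialized formulas come from the right-trivialized ones by inversion, which `τ` turns
into `ξ ↦ -ξ`. -/
theorem hasLeftDerivAt (hτ : IsCanonicalChart τ) {ξ : E} (hξ : ξ ∈ τ.source) :
    HasLeftDerivAt 𝓘(ℝ, E) 𝓘(ℝ, E) τ ξ (dtau τ (-ξ)) := by
  have hneg := (hτ.hasModelDerivAt_dtau (hτ.neg_mem ξ hξ)).comp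
    (hasModelDerivAt_iff_hasFDerivAt.2 (hasFDerivAt_id ξ).neg) rfl
  refine ((hasModelDerivAt_inv_of_eq_one hneg (mul_inv_cancel _)).congr_of_eventuallyEq
    ?_).congr_deriv (by ext; simp)
  filter_upwards [τ.open_source.mem_nhds hξ] with y hy
  simp [hτ.map_neg hy, hτ.map_neg hξ]

theorem hasModelDerivAt_symm_mul (hτ : IsCanonicalChart τ) {ξ : E} (hξ : ξ ∈ τ.source) :
    HasModelDerivAt 𝓘(ℝ, E) 𝓘(ℝ, E) (fun x : G => τ.symm (τ ξ * x)) 1 (dtauInv τ (-ξ)) := by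
  have hinv := (hτ.hasModelDerivAt_dtauInv (hτ.neg_mem ξ hξ)).comp
    (hasModelDerivAt_inv_of_eq_one (hasModelDerivAt_id (I := 𝓘(ℝ, E)) (1 : G)) rfl) inv_one
  refine (((hasModelDerivAt_iff_hasFDerivAt.2 (hasFDerivAt_id _).neg).comp hinv
    rfl).congr_of_eventuallyEq ?_).congr_deriv (by ext; simp)
  have hmem : ∀ᶠ x : G in 𝓝 1, τ ξ * x ∈ τ.target :=
    (mdifferentiableAt_mul_left (I := 𝓘(ℝ, E))).continuousAt.eventually_mem
      (τ.open_target.mem_nhds ((mul_one (τ ξ)).symm ▸ τ.map_source hξ))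
  filter_upwards [hmem] with x hx
  rw [hτ.map_neg hξ, ← mul_inv_rev, hτ.symm_inv hx, Pi.neg_apply, id_eq, neg_neg]

theorem dtauInv_comp_dtau (hτ : IsCanonicalChart τ) {ξ : E} (hξ : ξ ∈ τ.source) :
    (dtauInv τ ξ).comp (dtau τ ξ) = ContinuousLinearMap.id ℝ E := by
  refine ((hτ.hasModelDerivAt_dtauInv hξ).comp (hτ.hasModelDerivAt_dtau hξ)
    (mul_inv_cancel _)).unique ((hasModelDerivAt_id ξ).congr_of_eventuallyEq ?_)
  filter_upwards [τ.open_source.mem_nhds hξ] with y hy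
  rw [inv_mul_cancel_right, τ.left_inv hy]

theorem dtau_comp_dtauInv (hτ : IsCanonicalChart τ) {ξ : E} (hξ : ξ ∈ τ.source) :
    (dtau τ ξ).comp (dtauInv τ ξ) = ContinuousLinearMap.id ℝ E := by
  refine ((hτ.hasModelDerivAt_dtau hξ).comp (hτ.hasModelDerivAt_dtauInv hξ)
    (by rw [one_mul, τ.left_inv hξ])).unique
    ((hasModelDerivAt_id (I := 𝓘(ℝ, E)) (1 : G)).congr_of_eventuallyEq ?_)
  filter_upwards [eventually_mul_mem_target hξ] with x hx
  rw [τ.right_inv hx, mul_inv_cancel_right]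

theorem dtau_neg_comp_dtauInv (hτ : IsCanonicalChart τ) {ξ : E} (hξ : ξ ∈ τ.source) :
    (dtau τ (-ξ)).comp (dtauInv τ ξ) = Ad 𝓘(ℝ, E) (τ ξ)⁻¹ := by
  refine (HasModelDerivAt.comp (hτ.hasLeftDerivAt hξ) (hτ.hasModelDerivAt_dtauInv hξ)
    (by rw [one_mul, τ.left_inv hξ])).unique
    ((hasModelDerivAt_conj (τ ξ)⁻¹).congr_of_eventuallyEq ?_)
  filter_upwards [eventually_mul_mem_target hξ] with x hx
  rw [τ.right_inv hx, inv_inv, mul_assoc]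

theorem dtauInv_neg_comp_Ad (hτ : IsCanonicalChart τ) {ξ : E} (hξ : ξ ∈ τ.source) :
    (dtauInv τ (-ξ)).comp (Ad 𝓘(ℝ, E) (τ ξ)⁻¹) = dtauInv τ ξ := by
  rw [← hτ.dtau_neg_comp_dtauInv hξ, ← ContinuousLinearMap.comp_assoc,
    hτ.dtauInv_comp_dtau (hτ.neg_mem ξ hξ), ContinuousLinearMap.id_comp]

end IsCanonicalChart

variable [LieGroup 𝓘(ℝ, E) 1 G]

theorem HasModelDerivAt.tau (hτ : IsCanonicalChart τ) {f : X → E} {x : X} {A : F →L[ℝ] E}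
    (hf : HasModelDerivAt I 𝓘(ℝ, E) f x A) (hx : f x ∈ τ.source) :
    HasLeftDerivAt I 𝓘(ℝ, E) (fun y => τ (f y)) x ((dtau τ (-f x)).comp A) :=
  HasLeftDerivAt.comp (hτ.hasLeftDerivAt hx) hf

namespace HasLeftDerivAt

variable {g k : X → G} {x : X} {A B : F →L[ℝ] E}

theorem tau_symm (hτ : IsCanonicalChart τ) (hg : HasLeftDerivAt I 𝓘(ℝ, E) g x A)
    (hx : g x ∈ τ.target) :
    HasModelDerivAt I 𝓘(ℝ, E) (fun y => τ.symm (g y)) x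
      ((dtauInv τ (-τ.symm (g x))).comp A) := by
  have h := (hτ.hasModelDerivAt_symm_mul (τ.map_target hx)).comp hg (inv_mul_cancel _)
  simpa only [τ.right_inv hx, mul_inv_cancel_left] using h

theorem tau_symm_inv_mul (hτ : IsCanonicalChart τ) (hg : HasLeftDerivAt I 𝓘(ℝ, E) g x A)
    (hk : HasLeftDerivAt I 𝓘(ℝ, E) k x B) (hx : (g x)⁻¹ * k x ∈ τ.target) :
    HasModelDerivAt I 𝓘(ℝ, E) (fun y => τ.symm ((g y)⁻¹ * k y)) x
      ((dtauInv τ (-τ.symm ((g x)⁻¹ * k x))).comp B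
        - (dtauInv τ (τ.symm ((g x)⁻¹ * k x))).comp A) := by
  have hAd := hτ.dtauInv_neg_comp_Ad (τ.map_target hx)
  rw [τ.right_inv hx] at hAd
  refine (tau_symm hτ (hg.inv_mul hk) hx).congr_deriv ?_
  rw [ContinuousLinearMap.comp_sub, ← ContinuousLinearMap.comp_assoc, hAd]

theorem lagrangian {ℓ : G × E → ℝ} {ζ : X → E} {Z : F →L[ℝ] E}
    (hℓ : MDifferentiableAt (𝓘(ℝ, E).prod 𝓘(ℝ, E)) 𝓘(ℝ, ℝ) ℓ (g x, ζ x))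
    (hg : HasLeftDerivAt I 𝓘(ℝ, E) g x A) (hζ : HasModelDerivAt I 𝓘(ℝ, E) ζ x Z) :
    HasModelDerivAt I 𝓘(ℝ, ℝ) (fun y => ℓ (g y, ζ y)) x
      ((gdG ℓ (g x) (ζ x)).comp A + (dXi ℓ (g x) (ζ x)).comp Z) := by
  have htranslate : MDifferentiableAt (𝓘(ℝ, E).prod 𝓘(ℝ, E)) 𝓘(ℝ, ℝ)
      (fun p : G × E => ℓ (g x * p.1, p.2)) (1, ζ x) :=
    MDifferentiableAt.comp_of_eq _ hℓ
      (((mdifferentiableAt_mul_left (I := 𝓘(ℝ, E))).comp _ mdifferentiableAt_fst).prodMk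
        mdifferentiableAt_snd) (by rw [mul_one])
  have hfst : HasModelDerivAt 𝓘(ℝ, E) 𝓘(ℝ, ℝ) (fun y : G => ℓ (g x * y, ζ x)) 1
      (gdG ℓ (g x) (ζ x)) :=
    hasModelDerivAt_mfderiv (MDifferentiableAt.comp (f := fun y : G => (y, ζ x)) 1 htranslate
      (mdifferentiableAt_id.prodMk mdifferentiableAt_const))
  have hsnd : HasModelDerivAt 𝓘(ℝ, E) 𝓘(ℝ, ℝ) (fun ζ' : E => ℓ (g x * 1, ζ')) (ζ x)
      (dXi ℓ (g x) (ζ x)) := by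
    rw [mul_one, hasModelDerivAt_iff_hasFDerivAt]
    exact (hℓ.comp (ζ x) (mdifferentiableAt_const.prodMk
      mdifferentiableAt_id)).differentiableAt.hasFDerivAt
  simpa only [mul_inv_cancel_left] using
    HasModelDerivAt.comp_prodMk htranslate hfst hsnd hg hζ (inv_mul_cancel _) rfl

end HasLeftDerivAt

end CanonicalChart

namespace DiscreteCurve

variable {E : Type*} [NormedAddCommGroup E] [NormedSpace ℝ E]
  {G : Type*} {N s : ℕ}

section Coefficients

variable [TopologicalSpace G] [Group G]

/-- The increment `τ⁻¹(g_k⁻¹ g_{k+1}) ∈ 𝔤` of the `k`-th step. -/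
def increment (τ : OpenPartialHomeomorph E G) (c : DiscreteCurve E G N s) (k : Fin N) : E :=
  τ.symm ((c.g k.castSucc)⁻¹ * c.g k.succ)

/-- The defect of the `i`-th internal stage equation, which is paired with `h μ_k^i` in the
action. -/
def stageDefect (τ : OpenPartialHomeomorph E G) (a : Fin s → Fin s → ℝ) (h : ℝ)
    (c : DiscreteCurve E G N s) (k : Fin N) (i : Fin s) : E :=
  h⁻¹ • τ.symm ((c.g k.castSucc)⁻¹ * c.stageG τ h k i) - ∑ j, a i j • c.Xi k.castSucc j

/-- The defect of the external stage equation, which is paired with `h μ_{k+1}` in the action. -/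
def stepDefect (τ : OpenPartialHomeomorph E G) (b : Fin s → ℝ) (h : ℝ)
    (c : DiscreteCurve E G N s) (k : Fin N) : E :=
  h⁻¹ • c.increment τ k - ∑ j, b j • c.Xi k.castSucc j

variable [ChartedSpace E G]

/-- The total force `h ∑_j b_j (dτ⁻¹_{hΘ_k^j})^* f_k^j` of the `k`-th step. -/
def stepForce (τ : OpenPartialHomeomorph E G) (b : Fin s → ℝ) (h : ℝ)
    (ℓ : G × E → ℝ) (c : DiscreteCurve E G N s) (k : Fin N) : E →L[ℝ] ℝ :=
  h • ∑ j, b j • dual (dtauInv τ (h • c.Theta k.castSucc j)) (c.force τ h ℓ k j)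

/-- The left-trivialized derivative of the action of the `k`-th step with respect to `g_k`; its
negative is the momentum at time `t_k` (discrete Legendre transform). -/
def coeffStart (τ : OpenPartialHomeomorph E G) (b : Fin s → ℝ) (h : ℝ)
    (ℓ : G × E → ℝ) (c : DiscreteCurve E G N s) (k : Fin N) : E →L[ℝ] ℝ :=
  c.stepForce τ b h ℓ k - dual (dtauInv τ (c.increment τ k)) (c.mu k.succ)

/-- The left-trivialized derivative of the action of the `k`-th step with respect to `g_{k+1}`,
which is the momentum at time `t_{k+1}` (discrete Legendre transform). -/
def coeffEnd (τ : OpenPartialHomeomorph E G) (c : DiscreteCurve E G N s) (k : Fin N) :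
    E →L[ℝ] ℝ :=
  dual (dtauInv τ (-c.increment τ k)) (c.mu k.succ)

/-- The derivative of the action with respect to `Θ_k^i`. -/
def coeffTheta (τ : OpenPartialHomeomorph E G) (b : Fin s → ℝ) (h : ℝ)
    (ℓ : G × E → ℝ) (c : DiscreteCurve E G N s) (k : Fin N) (i : Fin s) : E →L[ℝ] ℝ :=
  h • (c.muStage k.castSucc i + (h * b i) • c.force τ h ℓ k i)

/-- The derivative of the action with respect to `Ξ_k^i`. -/
def coeffXi (τ : OpenPartialHomeomorph E G) (a : Fin s → Fin s → ℝ) (b : Fin s → ℝ) (h : ℝ)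
    (ℓ : G × E → ℝ) (c : DiscreteCurve E G N s) (k : Fin N) (i : Fin s) : E →L[ℝ] ℝ :=
  h • (b i • dXi ℓ (c.stageG τ h k i) (c.Xi k.castSucc i)
    - ∑ j, a j i • c.muStage k.castSucc j - b i • c.mu k.succ)

end Coefficients

section Differential

variable {X : Type*} [NormedAddCommGroup X] [NormedSpace ℝ X]

/-- The derivative of a family of discrete curves parametrised by `X`, left-trivialized in the
`g_k`. Like discrete curves it carries entries for `μ_0` and for the stages at `k = N`, which do
not enter the action. -/
structure CurveDifferential (X E : Type*) [NormedAddCommGroup X] [NormedSpace ℝ X]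
    [NormedAddCommGroup E] [NormedSpace ℝ E] (N s : ℕ) where
  g : Fin (N + 1) → X →L[ℝ] E
  mu : Fin (N + 1) → X →L[ℝ] E →L[ℝ] ℝ
  Theta : Fin (N + 1) → Fin s → X →L[ℝ] E
  Xi : Fin (N + 1) → Fin s → X →L[ℝ] E
  muStage : Fin (N + 1) → Fin s → X →L[ℝ] E →L[ℝ] ℝ

/-- `D` is the derivative at `x` of the family `c` of discrete curves, as far as the variables that
enter the action are concerned. -/
structure HasCurveDerivAt [TopologicalSpace G] [ChartedSpace E G] [Group G]
    (c : X → DiscreteCurve E G N s) (D : CurveDifferential X E N s) (x : X) : Prop where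
  g : ∀ k, HasLeftDerivAt 𝓘(ℝ, X) 𝓘(ℝ, E) (fun y => (c y).g k) x (D.g k)
  mu : ∀ k : Fin N, HasFDerivAt (fun y => (c y).mu k.succ) (D.mu k.succ) x
  Theta : ∀ (k : Fin N) i, HasFDerivAt (fun y => (c y).Theta k.castSucc i) (D.Theta k.castSucc i) x
  Xi : ∀ (k : Fin N) i, HasFDerivAt (fun y => (c y).Xi k.castSucc i) (D.Xi k.castSucc i) x
  muStage : ∀ (k : Fin N) i,
    HasFDerivAt (fun y => (c y).muStage k.castSucc i) (D.muStage k.castSucc i) x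

/-- The derivative of the action sum along a family of discrete curves through `c` with
derivative `D`. -/
def firstVariation [TopologicalSpace G] [ChartedSpace E G] [Group G]
    (τ : OpenPartialHomeomorph E G) (a : Fin s → Fin s → ℝ) (b : Fin s → ℝ)
    (h : ℝ) (ℓ : G × E → ℝ) (c : DiscreteCurve E G N s) (D : CurveDifferential X E N s) :
    X →L[ℝ] ℝ :=
  ∑ k : Fin N, ((c.coeffStart τ b h ℓ k).comp (D.g k.castSucc) + (c.coeffEnd τ k).comp (D.g k.succ)
    + ∑ i, ((c.coeffTheta τ b h ℓ k i).comp (D.Theta k.castSucc i)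
      + (c.coeffXi τ a b h ℓ k i).comp (D.Xi k.castSucc i)
      + h • (D.muStage k.castSucc i).flip (c.stageDefect τ a h k i))
    + h • (D.mu k.succ).flip (c.stepDefect τ b h k))

end Differential

theorem symm_inv_mul_stageG [TopologicalSpace G] [Group G] {τ : OpenPartialHomeomorph E G} {h : ℝ}
    {c : DiscreteCurve E G N s} {k : Fin N} {i : Fin s}
    (hc : h • c.Theta k.castSucc i ∈ τ.source) :
    τ.symm ((c.g k.castSucc)⁻¹ * c.stageG τ h k i) = h • c.Theta k.castSucc i := by
  rw [stageG, inv_mul_cancel_left, τ.left_inv hc]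

variable [TopologicalSpace G] [ChartedSpace E G] [Group G] {τ : OpenPartialHomeomorph E G}
  {a : Fin s → Fin s → ℝ} {b : Fin s → ℝ} {h : ℝ} {ℓ : G × E → ℝ}
  {X : Type*} [NormedAddCommGroup X] [NormedSpace ℝ X]
  {c : X → DiscreteCurve E G N s} {D : CurveDifferential X E N s} {x : X}

namespace HasCurveDerivAt

theorem eventually_smul_Theta_mem (hc : HasCurveDerivAt c D x) {k : Fin N} {i : Fin s}
    (hx : h • (c x).Theta k.castSucc i ∈ τ.source) :
    ∀ᶠ y in 𝓝 x, h • (c y).Theta k.castSucc i ∈ τ.source :=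
  ((hc.Theta k i).continuousAt.const_smul h).eventually_mem (τ.open_source.mem_nhds hx)

theorem stageDefect (hc : HasCurveDerivAt c D x) (hh : h ≠ 0) {k : Fin N} {i : Fin s}
    (hx : h • (c x).Theta k.castSucc i ∈ τ.source) :
    HasFDerivAt (fun y => (c y).stageDefect τ a h k i)
      (D.Theta k.castSucc i - ∑ j, a i j • D.Xi k.castSucc j) x := by
  refine ((hc.Theta k i).sub (HasFDerivAt.fun_sum fun j _ =>
    (hc.Xi k j).const_smul (a i j))).congr_of_eventuallyEq ?_
  filter_upwards [hc.eventually_smul_Theta_mem hx] with y hy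
  rw [DiscreteCurve.stageDefect, symm_inv_mul_stageG hy, inv_smul_smul₀ hh]
  rfl

variable [LieGroup 𝓘(ℝ, E) 1 G]

theorem stepDefect (hc : HasCurveDerivAt c D x) (hτ : IsCanonicalChart τ) {k : Fin N}
    (hx : ((c x).g k.castSucc)⁻¹ * (c x).g k.succ ∈ τ.target) :
    HasFDerivAt (fun y => (c y).stepDefect τ b h k)
      (h⁻¹ • ((dtauInv τ (-(c x).increment τ k)).comp (D.g k.succ)
        - (dtauInv τ ((c x).increment τ k)).comp (D.g k.castSucc))
        - ∑ j, b j • D.Xi k.castSucc j) x :=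
  ((hasModelDerivAt_iff_hasFDerivAt.1
    (HasLeftDerivAt.tau_symm_inv_mul hτ (hc.g k.castSucc) (hc.g k.succ) hx)).const_smul h⁻¹).sub
    (HasFDerivAt.fun_sum fun j _ => (hc.Xi k j).const_smul (b j))

theorem lagrangian (hc : HasCurveDerivAt c D x) (hτ : IsCanonicalChart τ) {k : Fin N} {i : Fin s}
    (hx : h • (c x).Theta k.castSucc i ∈ τ.source)
    (hℓ : MDifferentiable (𝓘(ℝ, E).prod 𝓘(ℝ, E)) 𝓘(ℝ, ℝ) ℓ) :
    HasFDerivAt (fun y => ℓ ((c y).stageG τ h k i, (c y).Xi k.castSucc i))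
      ((dual (dtauInv τ (h • (c x).Theta k.castSucc i)) ((c x).force τ h ℓ k i)).comp
          (D.g k.castSucc)
        + h • ((c x).force τ h ℓ k i).comp (D.Theta k.castSucc i)
        + (dXi ℓ ((c x).stageG τ h k i) ((c x).Xi k.castSucc i)).comp (D.Xi k.castSucc i)) x := by
  have hTheta := HasModelDerivAt.tau hτ
    (hasModelDerivAt_iff_hasFDerivAt.2 ((hc.Theta k i).const_smul h)) hx
  have hLagrangian := hasModelDerivAt_iff_hasFDerivAt.1 (HasLeftDerivAt.lagrangian
    (hℓ _) ((hc.g k.castSucc).mul hTheta) (hasModelDerivAt_iff_hasFDerivAt.2 (hc.Xi k i)))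
  refine hLagrangian.congr_fderiv ?_
  rw [Pi.smul_apply, ← hτ.dtau_neg_comp_dtauInv hx]
  ext v
  simp [force, dual, stageG]

end HasCurveDerivAt

variable [LieGroup 𝓘(ℝ, E) 1 G]

theorem hasFDerivAt_actionSum (hτ : IsCanonicalChart τ)
    (hℓ : MDifferentiable (𝓘(ℝ, E).prod 𝓘(ℝ, E)) 𝓘(ℝ, ℝ) ℓ) (hh : h ≠ 0)
    (hx : (c x).InChart τ h) (hc : HasCurveDerivAt c D x) :
    HasFDerivAt (fun y => actionSum τ a b h ℓ (c y)) ((c x).firstVariation τ a b h ℓ D) x := by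
  have hsum := HasFDerivAt.fun_sum (u := Finset.univ) fun (k : Fin N) _ =>
    (HasFDerivAt.fun_sum (u := Finset.univ) fun (i : Fin s) _ =>
      (((hc.lagrangian hτ ((hx k).2 i) hℓ).const_mul (b i)).add ((hc.muStage k i).clm_apply
        (hc.stageDefect (a := a) hh ((hx k).2 i)))).const_mul h).add
      (((hc.mu k).clm_apply (hc.stepDefect (b := b) (h := h) hτ (hx k).1)).const_mul h)
  refine hsum.congr_fderiv (Finset.sum_congr rfl fun k _ => ?_)
  ext v
  have htranspose : ∑ i, ∑ j, h * (a i j * (c x).muStage k.castSucc i (D.Xi k.castSucc j v))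
      = ∑ i, ∑ j, h * (a j i * (c x).muStage k.castSucc j (D.Xi k.castSucc i v)) := Finset.sum_comm
  simp only [coeffStart, coeffEnd, coeffTheta, coeffXi, stepForce, dual, add_apply, sub_apply,
    sum_apply, smul_apply, ContinuousLinearMap.comp_apply, ContinuousLinearMap.flip_apply,
    smul_eq_mul, map_sub, map_smul, map_sum, mul_add, mul_sub, Finset.sum_add_distrib,
    Finset.sum_sub_distrib, Finset.mul_sum, mul_inv_cancel_left₀ hh, htranspose, mul_assoc,
    mul_left_comm (b _) h]
  ring

end DiscreteCurve

namespace DiscreteCurve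

variable {E : Type*} [NormedAddCommGroup E] [NormedSpace ℝ E]
  {G : Type*} [TopologicalSpace G] [ChartedSpace E G] [Group G] {N s : ℕ}
  {τ : OpenPartialHomeomorph E G} {a : Fin s → Fin s → ℝ} {b : Fin s → ℝ} {h : ℝ} {ℓ : G × E → ℝ}

section FundamentalLemma

/-- The discrete Hamilton–Pontryagin equations with momenta `p_0, …, p_N ∈ 𝔤*`: the derivatives of
the action with respect to all variables other than the `g_k` vanish, and its `k`-th step generates
the momenta at both ends of that step. -/
structure SatisfiesHamiltonPontryagin (τ : OpenPartialHomeomorph E G) (a : Fin s → Fin s → ℝ)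
    (b : Fin s → ℝ) (h : ℝ) (ℓ : G × E → ℝ) (c : DiscreteCurve E G N s)
    (p : Fin (N + 1) → E →L[ℝ] ℝ) : Prop where
  coeffTheta : ∀ k i, c.coeffTheta τ b h ℓ k i = 0
  coeffXi : ∀ k i, c.coeffXi τ a b h ℓ k i = 0
  stageDefect : ∀ k i, c.stageDefect τ a h k i = 0
  stepDefect : ∀ k, c.stepDefect τ b h k = 0
  coeffStart : ∀ k, c.coeffStart τ b h ℓ k = -p k.castSucc
  coeffEnd : ∀ k, c.coeffEnd τ k = p k.succ

theorem sum_succ_sub_castSucc {V : Type*} [AddCommGroup V] (f : Fin (N + 1) → V) :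
    ∑ k : Fin N, (f k.succ - f k.castSucc) = f (Fin.last N) - f 0 := by
  have h := (Fin.sum_univ_succ f).symm.trans (Fin.sum_univ_castSucc f)
  rw [Finset.sum_sub_distrib, sub_eq_sub_iff_add_eq_add, add_comm, h, add_comm]

theorem SatisfiesHamiltonPontryagin.firstVariation_eq {c : DiscreteCurve E G N s}
    {p : Fin (N + 1) → E →L[ℝ] ℝ} (hc : c.SatisfiesHamiltonPontryagin τ a b h ℓ p)
    {X : Type*} [NormedAddCommGroup X] [NormedSpace ℝ X] (D : CurveDifferential X E N s) :
    c.firstVariation τ a b h ℓ D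
      = (p (Fin.last N)).comp (D.g (Fin.last N)) - (p 0).comp (D.g 0) := by
  rw [← sum_succ_sub_castSucc fun k => (p k).comp (D.g k)]
  simp only [firstVariation, hc.coeffTheta, hc.coeffXi, hc.stageDefect, hc.stepDefect,
    hc.coeffStart, hc.coeffEnd, ContinuousLinearMap.zero_comp, map_zero, smul_zero, add_zero,
    Finset.sum_const_zero, ContinuousLinearMap.neg_comp, neg_add_eq_sub]

theorem exists_satisfiesHamiltonPontryagin {c : DiscreteCurve E G N s}
    (hTheta : ∀ k i, c.coeffTheta τ b h ℓ k i = 0) (hXi : ∀ k i, c.coeffXi τ a b h ℓ k i = 0)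
    (hstage : ∀ k i, c.stageDefect τ a h k i = 0) (hstep : ∀ k, c.stepDefect τ b h k = 0)
    (hnode : ∀ j k : Fin N, j.succ = k.castSucc → c.coeffStart τ b h ℓ k + c.coeffEnd τ j = 0) :
    ∃ p, c.SatisfiesHamiltonPontryagin τ a b h ℓ p := by
  cases N with
  | zero => exact ⟨0, hTheta, hXi, hstage, hstep, Fin.rec0, Fin.rec0⟩
  | succ n =>
    refine ⟨Fin.cons (-c.coeffStart τ b h ℓ 0) (c.coeffEnd τ), hTheta, hXi, hstage, hstep,
      Fin.cases (neg_neg _).symm fun k => ?_, fun _ => rfl⟩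
    rw [← Fin.succ_castSucc, Fin.cons_succ]
    exact eq_neg_of_add_eq_zero_left (hnode _ _ (Fin.succ_castSucc k))

theorem exists_satisfiesHamiltonPontryagin_of_firstVariation_eq_zero (hh : h ≠ 0)
    {c : DiscreteCurve E G N s}
    (hc : ∀ D : CurveDifferential ℝ E N s, D.g 0 = 0 → D.g (Fin.last N) = 0 →
      c.firstVariation τ a b h ℓ D = 0) : ∃ p, c.SatisfiesHamiltonPontryagin τ a b h ℓ p := by
  refine exists_satisfiesHamiltonPontryagin (fun k i => ?_) (fun k i => ?_) (fun k i => ?_)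
    (fun k => ?_) (fun j k hjk => ?_)
  · ext v
    simpa [firstVariation, -ite_smul, ite_and] using DFunLike.congr_fun
      (hc ⟨0, 0, fun k' i' =>
        (if k' = k.castSucc ∧ i' = i then (1 : ℝ) else 0) • .toSpanSingleton ℝ v, 0, 0⟩ rfl rfl) 1
  · ext v
    simpa [firstVariation, -ite_smul, ite_and] using DFunLike.congr_fun
      (hc ⟨0, 0, 0, fun k' i' =>
        (if k' = k.castSucc ∧ i' = i then (1 : ℝ) else 0) • .toSpanSingleton ℝ v, 0⟩ rfl rfl) 1
  · refine SeparatingDual.eq_zero_of_forall_dual_eq_zero (R := ℝ) fun φ => ?_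
    simpa [firstVariation, -ite_smul, ite_and, hh] using DFunLike.congr_fun
      (hc ⟨0, 0, 0, 0, fun k' i' =>
        (if k' = k.castSucc ∧ i' = i then (1 : ℝ) else 0) • .toSpanSingleton ℝ φ⟩ rfl rfl) 1
  · refine SeparatingDual.eq_zero_of_forall_dual_eq_zero (R := ℝ) fun φ => ?_
    simpa [firstVariation, -ite_smul, ite_and, hh] using DFunLike.congr_fun
      (hc ⟨0, fun k' => (if k' = k.succ then (1 : ℝ) else 0) • .toSpanSingleton ℝ φ, 0, 0, 0⟩
        rfl rfl) 1
  · have hk : ∀ k' : Fin N, k'.castSucc = j.succ ↔ k' = k := by simp [hjk]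
    have hfirst : (0 : Fin (N + 1)) ≠ j.succ := (Fin.succ_ne_zero j).symm
    have hlast : Fin.last N ≠ j.succ := hjk ▸ (Fin.castSucc_lt_last k).ne'
    ext v
    simpa [firstVariation, -ite_smul, hk, Finset.sum_add_distrib] using DFunLike.congr_fun
      (hc ⟨fun k' => (if k' = j.succ then (1 : ℝ) else 0) • .toSpanSingleton ℝ v, 0, 0, 0, 0⟩
        (by simp only [if_neg hfirst, zero_smul]) (by simp only [if_neg hlast, zero_smul])) 1

end FundamentalLemma

section Variations

/-- The variation of `c` in the direction `D`. The factor `dτ⁻¹_0` makes `D.g k` the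
left-trivialized velocity of the `g_k`. -/
def vary (τ : OpenPartialHomeomorph E G) (c : DiscreteCurve E G N s)
    (D : CurveDifferential ℝ E N s) (ε : ℝ) : DiscreteCurve E G N s where
  g k := c.g k * τ (dtauInv τ 0 (D.g k ε))
  mu k := c.mu k + D.mu k ε
  Theta k i := c.Theta k i + D.Theta k i ε
  Xi k i := c.Xi k i + D.Xi k i ε
  muStage k i := c.muStage k i + D.muStage k i ε

variable {c : DiscreteCurve E G N s} {D : CurveDifferential ℝ E N s} {g₁ g₂ : G}

theorem vary_zero (hτ : IsCanonicalChart τ) : c.vary τ D 0 = c := by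
  ext <;> simp [vary, hτ.map_zero]

theorem isVariation_vary [ContMDiffMul 𝓘(ℝ, E) ∞ G] (hτ : IsCanonicalChart τ)
    (hc : c ∈ pathSpace E N s g₁ g₂) (hfirst : D.g 0 = 0) (hlast : D.g (Fin.last N) = 0) :
    IsVariation g₁ g₂ c (c.vary τ D) where
  at_zero := vary_zero hτ
  mem ε := by simpa [pathSpace, vary, hfirst, hlast, hτ.map_zero] using hc
  smooth_g k := by
    have hlin : ContMDiffAt 𝓘(ℝ, ℝ) 𝓘(ℝ, E) ∞ (fun ε => dtauInv τ 0 (D.g k ε)) 0 :=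
      ((dtauInv τ 0).comp (D.g k)).contMDiff 0
    refine contMDiffAt_const.mul (ContMDiffAt.comp 0 (hτ.smooth.contMDiffAt ?_) hlin)
    simpa using τ.open_source.mem_nhds hτ.zero_mem
  smooth_mu k := contDiffAt_const.add (D.mu k).contDiff.contDiffAt
  smooth_Theta k i := contDiffAt_const.add (D.Theta k i).contDiff.contDiffAt
  smooth_Xi k i := contDiffAt_const.add (D.Xi k i).contDiff.contDiffAt
  smooth_muStage k i := contDiffAt_const.add (D.muStage k i).contDiff.contDiffAt

variable [LieGroup 𝓘(ℝ, E) 1 G]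

theorem hasCurveDerivAt_vary (hτ : IsCanonicalChart τ) : HasCurveDerivAt (c.vary τ D) D 0 where
  g k := by
    have htau := HasModelDerivAt.tau hτ (hasModelDerivAt_iff_hasFDerivAt.2
      ((dtauInv τ 0).comp (D.g k)).hasFDerivAt) (x := (0 : ℝ)) (by simpa using hτ.zero_mem)
    refine HasModelDerivAt.congr_deriv ((hasLeftDerivAt_const (c.g k) 0).mul htau) ?_
    rw [ContinuousLinearMap.comp_zero, zero_add, map_zero, neg_zero,
      ← ContinuousLinearMap.comp_assoc, hτ.dtau_comp_dtauInv hτ.zero_mem,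
      ContinuousLinearMap.id_comp]
  mu k := (D.mu k.succ).hasFDerivAt.const_add _
  Theta k i := (D.Theta k.castSucc i).hasFDerivAt.const_add _
  Xi k i := (D.Xi k.castSucc i).hasFDerivAt.const_add _
  muStage k i := (D.muStage k.castSucc i).hasFDerivAt.const_add _

theorem IsVariation.exists_hasCurveDerivAt {γ : ℝ → DiscreteCurve E G N s}
    (hγ : IsVariation g₁ g₂ c γ) : ∃ D : CurveDifferential ℝ E N s,
      HasCurveDerivAt γ D 0 ∧ D.g 0 = 0 ∧ D.g (Fin.last N) = 0 := by
  have hleft_const : ∀ k g, (∀ ε, (γ ε).g k = g) →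
      leftDeriv 𝓘(ℝ, ℝ) 𝓘(ℝ, E) (fun ε => (γ ε).g k) 0 = 0 := fun k g hg =>
    (funext hg : (fun ε => (γ ε).g k) = fun _ => g) ▸ (hasLeftDerivAt_const g 0).leftDeriv_eq
  exact ⟨⟨fun k => leftDeriv 𝓘(ℝ, ℝ) 𝓘(ℝ, E) (fun ε => (γ ε).g k) 0,
      fun k => fderiv ℝ (fun ε => (γ ε).mu k) 0,
      fun k i => fderiv ℝ (fun ε => (γ ε).Theta k i) 0,
      fun k i => fderiv ℝ (fun ε => (γ ε).Xi k i) 0,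
      fun k i => fderiv ℝ (fun ε => (γ ε).muStage k i) 0⟩,
    ⟨fun k => hasLeftDerivAt_leftDeriv ((hγ.smooth_g k).mdifferentiableAt (by simp)),
      fun k => ((hγ.smooth_mu k.succ).differentiableAt (by simp)).hasFDerivAt,
      fun k i => ((hγ.smooth_Theta k.castSucc i).differentiableAt (by simp)).hasFDerivAt,
      fun k i => ((hγ.smooth_Xi k.castSucc i).differentiableAt (by simp)).hasFDerivAt,
      fun k i => ((hγ.smooth_muStage k.castSucc i).differentiableAt (by simp)).hasFDerivAt⟩,
    hleft_const 0 g₁ fun ε => (hγ.mem ε).1, hleft_const _ g₂ fun ε => (hγ.mem ε).2⟩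

theorem isCritical_iff_exists_satisfiesHamiltonPontryagin [ContMDiffMul 𝓘(ℝ, E) ∞ G]
    (hτ : IsCanonicalChart τ)
    (hℓ : MDifferentiable (𝓘(ℝ, E).prod 𝓘(ℝ, E)) 𝓘(ℝ, ℝ) ℓ) (hh : h ≠ 0)
    (hc : c ∈ pathSpace E N s g₁ g₂) (hchart : c.InChart τ h) :
    c.IsCritical τ a b h ℓ g₁ g₂ ↔ ∃ p, c.SatisfiesHamiltonPontryagin τ a b h ℓ p := by
  have hderiv : ∀ {γ : ℝ → DiscreteCurve E G N s} {D}, γ 0 = c → HasCurveDerivAt γ D 0 →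
      HasFDerivAt (fun ε => actionSum τ a b h ℓ (γ ε)) (c.firstVariation τ a b h ℓ D) 0 := by
    rintro γ D rfl hγ
    exact hasFDerivAt_actionSum hτ hℓ hh hchart hγ
  constructor
  · intro hcrit
    refine exists_satisfiesHamiltonPontryagin_of_firstVariation_eq_zero hh
      fun D hfirst hlast => ?_
    have hzero := (hcrit _ (isVariation_vary hτ hc hfirst hlast)).hasFDerivAt
    rw [(hderiv (vary_zero hτ) (hasCurveDerivAt_vary hτ)).unique hzero,
      ContinuousLinearMap.toSpanSingleton_zero]
  · rintro ⟨p, hp⟩ γ hγ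
    obtain ⟨D, hD, hfirst, hlast⟩ := hγ.exists_hasCurveDerivAt
    refine (hderiv hγ.at_zero hD).hasDerivAt.congr_deriv ?_
    rw [hp.firstVariation_eq, hfirst, hlast, ContinuousLinearMap.comp_zero,
      ContinuousLinearMap.comp_zero, sub_zero, zero_apply]

end Variations

end DiscreteCurve

section Dual

variable {E : Type*} [NormedAddCommGroup E] [NormedSpace ℝ E]

theorem dual_dual_of_comp_eq_id {A B : E →L[ℝ] E} (h : A.comp B = ContinuousLinearMap.id ℝ E)
    (μ : E →L[ℝ] ℝ) : dual B (dual A μ) = μ := by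
  rw [dual, dual, ContinuousLinearMap.comp_assoc, h, ContinuousLinearMap.comp_id]

theorem IsCanonicalChart.bijective_dual_dtauInv {G : Type*} [TopologicalSpace G]
    [ChartedSpace E G] [Group G] [LieGroup 𝓘(ℝ, E) 1 G] {τ : OpenPartialHomeomorph E G}
    (hτ : IsCanonicalChart τ) {ξ : E} (hξ : ξ ∈ τ.source) :
    Function.Bijective (dual (dtauInv τ ξ)) :=
  Function.bijective_iff_has_inverse.2 ⟨dual (dtau τ ξ),
    dual_dual_of_comp_eq_id (hτ.dtauInv_comp_dtau hξ),
    dual_dual_of_comp_eq_id (hτ.dtau_comp_dtauInv hξ)⟩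

theorem dual_stageMomentum_iff {s : ℕ} {a : Fin s → Fin s → ℝ} {b : Fin s → ℝ} {h : ℝ}
    {A : E →L[ℝ] E} (hA : Function.Injective (dual A)) {i : Fin s} (hb : b i ≠ 0)
    {p μ M : E →L[ℝ] ℝ} {f P : Fin s → E →L[ℝ] ℝ} (hμ : dual A μ = p + h • ∑ j, b j • P j) :
    dual A M = p + h • ∑ j, (b j • P j - (b j * a j i / b i) • dual A (f j)) ↔
      b i • M - ∑ j, a j i • -((h * b j) • f j) - b i • μ = 0 := by
  have hright : p + h • ∑ j, (b j • P j - (b j * a j i / b i) • dual A (f j))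
      = dual A (μ - h • ∑ j, (b j * a j i / b i) • f j) := by
    rw [Finset.sum_sub_distrib, smul_sub, ← add_sub_assoc, ← hμ]
    ext v
    simp [dual]
  have hleft : b i • M - ∑ j, a j i • -((h * b j) • f j) - b i • μ
      = b i • (M - (μ - h • ∑ j, (b j * a j i / b i) • f j)) := by
    have hcoeff : ∀ j, b i * (h * (b j * a j i / b i)) = a j i * (h * b j) := fun j => by
      field_simp
    simp only [smul_sub, smul_neg, Finset.smul_sum, smul_smul, Finset.sum_neg_distrib, hcoeff]
    abel
  rw [hright, hleft, hA.eq_iff, smul_eq_zero_iff_right hb, sub_eq_zero]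

end Dual

namespace DiscreteCurve

variable {E : Type*} [NormedAddCommGroup E] [NormedSpace ℝ E]
  {G : Type*} {N s : ℕ} {c : DiscreteCurve E G N s}

theorem withMuZero_mu_zero (ν : E →L[ℝ] ℝ) : (c.withMuZero ν).mu 0 = ν :=
  Function.update_self (β := fun _ => E →L[ℝ] ℝ) 0 ν c.mu

theorem withMuZero_mu_succ (ν : E →L[ℝ] ℝ) (k : Fin N) :
    (c.withMuZero ν).mu k.succ = c.mu k.succ :=
  Function.update_of_ne (Fin.succ_ne_zero k) ν c.mu

variable [TopologicalSpace G] [Group G] {τ : OpenPartialHomeomorph E G}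
  {a : Fin s → Fin s → ℝ} {b : Fin s → ℝ} {h : ℝ}

theorem stepDefect_eq_zero_iff (hh : h ≠ 0) {k : Fin N} :
    c.stepDefect τ b h k = 0 ↔ h • ∑ j, b j • c.Xi k.castSucc j = c.increment τ k := by
  rw [stepDefect, sub_eq_zero, inv_smul_eq_iff₀ hh, eq_comm]

variable [ChartedSpace E G] {ℓ : G × E → ℝ} {ξ : Fin (N + 1) → E}
  {M : Fin N → Fin s → (E →L[ℝ] ℝ)}

theorem coeffTheta_eq_zero_iff (hh : h ≠ 0) {k : Fin N} {i : Fin s} :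
    c.coeffTheta τ b h ℓ k i = 0 ↔
      c.muStage k.castSucc i = -((h * b i) • c.force τ h ℓ k i) := by
  rw [coeffTheta, smul_eq_zero_iff_right hh, add_eq_zero_iff_eq_neg]

theorem coeffStart_eq_neg_iff {k : Fin N} {p : E →L[ℝ] ℝ} :
    c.coeffStart τ b h ℓ k = -p ↔
      dual (dtauInv τ (c.increment τ k)) (c.mu k.succ) = p + c.stepForce τ b h ℓ k := by
  rw [coeffStart, sub_eq_iff_eq_add, neg_add_eq_sub, eq_sub_iff_add_eq, eq_comm, add_comm]

theorem momentum_succ_eq_coeffEnd {k : Fin N} (hξ : h • ξ k.succ = c.increment τ k) :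
    c.momentum τ h ξ k.succ = c.coeffEnd τ k := by
  rw [momentum, coeffEnd, hξ]

theorem stageMomentum_iff_coeffXi_eq_zero [LieGroup 𝓘(ℝ, E) 1 G] (hτ : IsCanonicalChart τ)
    (hh : h ≠ 0) {k : Fin N} (hchart : (c.g k.castSucc)⁻¹ * c.g k.succ ∈ τ.target)
    (hTheta : ∀ j, c.coeffTheta τ b h ℓ k j = 0) {p : E →L[ℝ] ℝ}
    (hstart : c.coeffStart τ b h ℓ k = -p) {i : Fin s} (hb : b i ≠ 0) :
    dual (dtauInv τ (c.increment τ k)) (dXi ℓ (c.stageG τ h k i) (c.Xi k.castSucc i))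
        = p + h • ∑ j, (b j • dual (dtauInv τ (h • c.Theta k.castSucc j)) (c.force τ h ℓ k j)
          - (b j * a j i / b i) • dual (dtauInv τ (c.increment τ k)) (c.force τ h ℓ k j)) ↔
      c.coeffXi τ a b h ℓ k i = 0 := by
  have hinjective : Function.Injective (dual (dtauInv τ (c.increment τ k))) :=
    (hτ.bijective_dual_dtauInv (τ.map_target hchart)).injective
  rw [dual_stageMomentum_iff hinjective hb (coeffStart_eq_neg_iff.1 hstart), coeffXi,
    smul_eq_zero_iff_right hh]
  simp only [fun j => (coeffTheta_eq_zero_iff hh).1 (hTheta j)]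

theorem isVPRK_iff_satisfiesHamiltonPontryagin [LieGroup 𝓘(ℝ, E) 1 G] (hτ : IsCanonicalChart τ)
    (hh : h ≠ 0) (hb : ∀ i, b i ≠ 0) (hchart : c.InChart τ h)
    (hTheta : ∀ k i, c.coeffTheta τ b h ℓ k i = 0) :
    c.IsVPRK τ a b h ℓ ξ M ↔ c.SatisfiesHamiltonPontryagin τ a b h ℓ (c.momentum τ h ξ) ∧
      (∀ k : Fin N, ∑ j, b j • c.Xi k.castSucc j = ξ k.succ) ∧
      ∀ k i, M k i = dXi ℓ (c.stageG τ h k i) (c.Xi k.castSucc i) := by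
  constructor
  · intro hc
    have hstep : ∀ k, c.stepDefect τ b h k = 0 := fun k => sub_eq_zero.2 (hc.external k).1
    have hξ : ∀ k : Fin N, h • ξ k.succ = c.increment τ k := fun k =>
      (hc.external k).2 ▸ (stepDefect_eq_zero_iff hh).1 (hstep k)
    have hstart : ∀ k, c.coeffStart τ b h ℓ k = -c.momentum τ h ξ k.castSucc := fun k =>
      coeffStart_eq_neg_iff.2 (hξ k ▸ hc.externalMomentum k)
    refine ⟨⟨hTheta, fun k i => ?_, fun k i => sub_eq_zero.2 (hc.internal k i).1, hstep, hstart,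
      fun k => (momentum_succ_eq_coeffEnd (hξ k)).symm⟩, fun k => (hc.external k).2, hc.legendre⟩
    rw [← stageMomentum_iff_coeffXi_eq_zero hτ hh (hchart k).1 (hTheta k) (hstart k) (hb i),
      ← hc.legendre k i, ← hξ k]
    exact hc.stageMomentum k i
  · rintro ⟨hp, hsum, hM⟩
    have hξ : ∀ k : Fin N, h • ξ k.succ = c.increment τ k := fun k =>
      hsum k ▸ (stepDefect_eq_zero_iff hh).1 (hp.stepDefect k)
    refine ⟨fun k i => ?_, fun k => ⟨sub_eq_zero.1 (hp.stepDefect k), hsum k⟩, fun k i => ?_,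
      fun k => ?_, hM⟩
    · have hstage := sub_eq_zero.1 (hp.stageDefect k i)
      refine ⟨hstage, hstage.symm.trans ?_⟩
      rw [symm_inv_mul_stageG ((hchart k).2 i), inv_smul_smul₀ hh]
    · rw [hM, hξ]
      exact (stageMomentum_iff_coeffXi_eq_zero hτ hh (hchart k).1 (hTheta k) (hp.coeffStart k)
        (hb i)).2 (hp.coeffXi k i)
    · rw [hξ]
      exact coeffStart_eq_neg_iff.1 (hp.coeffStart k)

theorem satisfiesVPRK_iff_exists_satisfiesHamiltonPontryagin [LieGroup 𝓘(ℝ, E) 1 G]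
    (hτ : IsCanonicalChart τ) (hh : h ≠ 0) (hb : ∀ i, b i ≠ 0) (hchart : c.InChart τ h)
    (hTheta : ∀ k i, c.coeffTheta τ b h ℓ k i = 0) {ξ₀ : E} :
    c.SatisfiesVPRK τ a b h ℓ ξ₀ ↔ ∃ p, c.SatisfiesHamiltonPontryagin τ a b h ℓ p ∧
      p 0 = dual (dtauInv τ (-(h • ξ₀))) (c.mu 0) := by
  constructor
  · rintro ⟨ξ, M, rfl, hc⟩
    exact ⟨_, ((isVPRK_iff_satisfiesHamiltonPontryagin hτ hh hb hchart hTheta).1 hc).1, rfl⟩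
  · rintro ⟨p, hp, hzero⟩
    let ξ : Fin (N + 1) → E := Fin.cons ξ₀ fun k => ∑ j, b j • c.Xi k.castSucc j
    have hmomentum : c.momentum τ h ξ = p := funext <| Fin.cases hzero.symm fun k =>
      (momentum_succ_eq_coeffEnd ((stepDefect_eq_zero_iff hh).1 (hp.stepDefect k))).trans
        (hp.coeffEnd k)
    exact ⟨ξ, _, rfl, (isVPRK_iff_satisfiesHamiltonPontryagin hτ hh hb hchart hTheta).2
      ⟨hmomentum.symm ▸ hp, fun _ => rfl, fun _ _ => rfl⟩⟩

theorem satisfiesHamiltonPontryagin_withMuZero_iff {ν : E →L[ℝ] ℝ}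
    {p : Fin (N + 1) → E →L[ℝ] ℝ} :
    (c.withMuZero ν).SatisfiesHamiltonPontryagin τ a b h ℓ p ↔
      c.SatisfiesHamiltonPontryagin τ a b h ℓ p := by
  have hXi : (c.withMuZero ν).coeffXi τ a b h ℓ = c.coeffXi τ a b h ℓ := by
    ext1; ext1; rw [coeffXi, withMuZero_mu_succ]; rfl
  have hstart : (c.withMuZero ν).coeffStart τ b h ℓ = c.coeffStart τ b h ℓ := by
    ext1; rw [coeffStart, withMuZero_mu_succ]; rfl
  have hend : (c.withMuZero ν).coeffEnd τ = c.coeffEnd τ := by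
    ext1; rw [coeffEnd, withMuZero_mu_succ]; rfl
  exact ⟨fun hp => ⟨hp.1, hXi ▸ hp.2, hp.3, hp.4, hstart ▸ hp.5, hend ▸ hp.6⟩,
    fun hp => ⟨hp.1, hXi ▸ hp.2, hp.3, hp.4, hstart ▸ hp.5, hend ▸ hp.6⟩⟩

theorem existsUnique_satisfiesVPRK_and_muStage_iff [LieGroup 𝓘(ℝ, E) 1 G]
    (hτ : IsCanonicalChart τ) (hh : h ≠ 0) (hb : ∀ i, b i ≠ 0) (hN : 0 < N)
    (hchart : c.InChart τ h) {ξ₀ : E} (hξ₀ : h • ξ₀ ∈ τ.source) :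
    ((∃! ν, (c.withMuZero ν).SatisfiesVPRK τ a b h ℓ ξ₀) ∧
        ∀ (k : Fin N) i, c.muStage k.castSucc i = -((h * b i) • c.force τ h ℓ k i)) ↔
      ∃ p, c.SatisfiesHamiltonPontryagin τ a b h ℓ p := by
  have hscheme : (∀ k i, c.coeffTheta τ b h ℓ k i = 0) → ∀ ν,
      (c.withMuZero ν).SatisfiesVPRK τ a b h ℓ ξ₀ ↔
        ∃ p, c.SatisfiesHamiltonPontryagin τ a b h ℓ p ∧
          p 0 = dual (dtauInv τ (-(h • ξ₀))) ν := fun hTheta ν => by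
    rw [satisfiesVPRK_iff_exists_satisfiesHamiltonPontryagin (c := c.withMuZero ν) hτ hh hb hchart
      hTheta, withMuZero_mu_zero]
    exact exists_congr fun p => and_congr_left' satisfiesHamiltonPontryagin_withMuZero_iff
  simp only [← coeffTheta_eq_zero_iff hh]
  constructor
  · rintro ⟨⟨ν, hν, -⟩, hTheta⟩
    obtain ⟨p, hp, -⟩ := (hscheme hTheta ν).1 hν
    exact ⟨p, hp⟩
  · rintro ⟨p, hp⟩
    have hp_zero : ∀ q, c.SatisfiesHamiltonPontryagin τ a b h ℓ q → q 0 = p 0 := fun q hq =>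
      neg_injective ((hq.coeffStart ⟨0, hN⟩).symm.trans (hp.coeffStart ⟨0, hN⟩))
    obtain ⟨ν, hν, hν_unique⟩ := (hτ.bijective_dual_dtauInv (hτ.neg_mem _ hξ₀)).existsUnique (p 0)
    refine ⟨⟨ν, (hscheme hp.coeffTheta ν).2 ⟨p, hp, hν.symm⟩, fun ν' hν' => hν_unique ν' ?_⟩,
      hp.coeffTheta⟩
    obtain ⟨q, hq, hq_zero⟩ := (hscheme hp.coeffTheta ν').1 hν'
    exact hq_zero.symm.trans (hp_zero q hq)

end DiscreteCurve

namespace DiscreteCurve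

variable {E : Type*} [NormedAddCommGroup E] [NormedSpace ℝ E]
  {G : Type*} [TopologicalSpace G] [Group G] {N s : ℕ}
  {a : Fin s → Fin s → ℝ} {b : Fin s → ℝ} {h : ℝ} {ℓ : G × E → ℝ}

/-- The action sum without the constraint terms. As a function of the initial data of a family of
solutions of the scheme it is a generating function of the discrete flow. -/
def lagrangianSum (τ : OpenPartialHomeomorph E G) (b : Fin s → ℝ) (h : ℝ) (ℓ : G × E → ℝ)
    (c : DiscreteCurve E G N s) : ℝ :=
  ∑ k : Fin N, ∑ i, h * (b i * ℓ (c.stageG τ h k i, c.Xi k.castSucc i))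

variable {τ : OpenPartialHomeomorph E G}

theorem actionSum_eq_lagrangianSum {c : DiscreteCurve E G N s}
    (hstage : ∀ k i, c.stageDefect τ a h k i = 0) (hstep : ∀ k, c.stepDefect τ b h k = 0) :
    actionSum τ a b h ℓ c = c.lagrangianSum τ b h ℓ := by
  refine Finset.sum_congr rfl fun k _ => ?_
  have hstep_k := hstep k
  have hstage_k := hstage k
  simp only [stepDefect, increment, stageDefect] at hstep_k hstage_k
  simp only [hstep_k, hstage_k, map_zero, mul_zero, add_zero]

variable [ChartedSpace E G] {X : Type*} [NormedAddCommGroup X] [NormedSpace ℝ X]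
  {c : X → DiscreteCurve E G N s}
  {ξ : X → Fin (N + 1) → E} {M : X → Fin N → Fin s → (E →L[ℝ] ℝ)} {x : X}
  {A : Fin (N + 1) → X →L[ℝ] E}

/- The multipliers may be frozen at their values at `x`, because the constraints which they multiply
hold along the family; then only the boundary terms of the first variation remain. -/
theorem hasFDerivAt_lagrangianSum [LieGroup 𝓘(ℝ, E) 1 G] (hτ : IsCanonicalChart τ)
    (hℓ : MDifferentiable (𝓘(ℝ, E).prod 𝓘(ℝ, E)) 𝓘(ℝ, ℝ) ℓ) (hh : h ≠ 0) (hb : ∀ i, b i ≠ 0)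
    (hchart : (c x).InChart τ h) (hc : ∀ᶠ y in 𝓝 x, (c y).IsVPRK τ a b h ℓ (ξ y) (M y))
    (hg : ∀ k, HasLeftDerivAt 𝓘(ℝ, X) 𝓘(ℝ, E) (fun y => (c y).g k) x (A k))
    (hXi : ∀ (k : Fin N) i, DifferentiableAt ℝ (fun y => (c y).Xi k.castSucc i) x) :
    HasFDerivAt (fun y => (c y).lagrangianSum τ b h ℓ)
      (((c x).momentum τ h (ξ x) (Fin.last N)).comp (A (Fin.last N))
        - ((c x).momentum τ h (ξ x) 0).comp (A 0)) x := by
  let γ : X → DiscreteCurve E G N s := fun y =>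
    { c y with
      mu := (c x).mu
      muStage := Fin.lastCases 0 fun k i => -((h * b i) • (c x).force τ h ℓ k i) }
  let D : CurveDifferential X E N s :=
    ⟨A, 0, fun k i => fderiv ℝ (fun y => (c y).Theta k i) x,
      fun k i => fderiv ℝ (fun y => (c y).Xi k i) x, 0⟩
  have hTheta : ∀ (k : Fin N) i, DifferentiableAt ℝ (fun y => (c y).Theta k.castSucc i) x :=
    fun k i => (DifferentiableAt.fun_sum fun j _ =>
      (hXi k j).const_smul (a i j)).congr_of_eventuallyEq
        (hc.mono fun y hy => (hy.internal k i).2.symm)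
  have hγ : HasCurveDerivAt γ D x :=
    ⟨hg, fun k => hasFDerivAt_const _ _, fun k i => (hTheta k i).hasFDerivAt,
      fun k i => (hXi k i).hasFDerivAt, fun k i => hasFDerivAt_const _ _⟩
  have hcx := hc.self_of_nhds
  have hγx : (γ x).IsVPRK τ a b h ℓ (ξ x) (M x) := ⟨hcx.1, hcx.2, hcx.3, hcx.4, hcx.5⟩
  have hTheta_stationary : ∀ k i, (γ x).coeffTheta τ b h ℓ k i = 0 := fun k i =>
    (coeffTheta_eq_zero_iff hh).2
      (congrFun (Fin.lastCases_castSucc (motive := fun _ => Fin s → E →L[ℝ] ℝ) (last := _)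
        (cast := _) k) i)
  have hHP := ((isVPRK_iff_satisfiesHamiltonPontryagin (c := γ x) hτ hh hb hchart
    hTheta_stationary).1 hγx).1
  have haction := hasFDerivAt_actionSum (c := γ) (a := a) (b := b) hτ hℓ hh hchart hγ
  rw [hHP.firstVariation_eq] at haction
  refine haction.congr_of_eventuallyEq (hc.mono fun y hy => ?_)
  exact (actionSum_eq_lagrangianSum (c := γ y) (fun k i => sub_eq_zero.2 (hy.internal k i).1)
    fun k => sub_eq_zero.2 (hy.external k).1).symm

end DiscreteCurve

section ExteriorDerivativeOnVectorSpace

variable {X : Type*} [NormedAddCommGroup X] [NormedSpace ℝ X]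
  {F : Type*} [NormedAddCommGroup F] [NormedSpace ℝ F]

/-- The one-form `β` on a vector space is differentiable at `x`, and its exterior derivative at `x`
is the two-form `Ω`. -/
def HasExteriorDerivAt (β : X → X →L[ℝ] ℝ) (Ω : X → X → ℝ) (x : X) : Prop :=
  ∃ B : X →L[ℝ] X →L[ℝ] ℝ, HasFDerivAt β B x ∧ ∀ v w, Ω v w = B v w - B w v

theorem HasExteriorDerivAt.congr_of_eventuallyEq {β β' : X → X →L[ℝ] ℝ} {Ω : X → X → ℝ} {x : X}
    (hβ : HasExteriorDerivAt β Ω x) (h : β' =ᶠ[𝓝 x] β) : HasExteriorDerivAt β' Ω x := by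
  obtain ⟨B, hB, hΩ⟩ := hβ
  exact ⟨B, hB.congr_of_eventuallyEq h, hΩ⟩

theorem HasExteriorDerivAt.eq_of_eventually_hasFDerivAt_sub {β₀ β₁ : X → X →L[ℝ] ℝ}
    {Ω₀ Ω₁ : X → X → ℝ} {x : X} {S : X → ℝ} (h₁ : HasExteriorDerivAt β₁ Ω₁ x)
    (h₀ : HasExteriorDerivAt β₀ Ω₀ x) (hS : ∀ᶠ y in 𝓝 x, HasFDerivAt S (β₁ y - β₀ y) y)
    (v w : X) : Ω₁ v w = Ω₀ v w := by
  obtain ⟨B₀, hB₀, hΩ₀⟩ := h₀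
  obtain ⟨B₁, hB₁, hΩ₁⟩ := h₁
  have hsymm : B₁ v w - B₀ v w = B₁ w v - B₀ w v :=
    second_derivative_symmetric_of_eventually hS (hB₁.sub hB₀) v w
  rw [hΩ₀, hΩ₁, sub_eq_sub_iff_sub_eq_sub]
  exact hsymm

theorem hasExteriorDerivAt_comp_fderiv {α : F → F →L[ℝ] ℝ} {q : X → F} {x : X}
    (hα : DifferentiableAt ℝ α (q x)) (hq : ContDiffAt ℝ 2 q x) :
    HasExteriorDerivAt (fun y => (α (q y)).comp (fderiv ℝ q y))
      (fun v w => fderiv ℝ α (q x) (fderiv ℝ q x v) (fderiv ℝ q x w)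
        - fderiv ℝ α (q x) (fderiv ℝ q x w) (fderiv ℝ q x v)) x := by
  have hq' : DifferentiableAt ℝ (fderiv ℝ q) x :=
    (hq.fderiv_right (m := 1) (by norm_num)).differentiableAt one_ne_zero
  have hαq := hα.hasFDerivAt.comp x (hq.differentiableAt two_ne_zero).hasFDerivAt
  have hsymm : IsSymmSndFDerivAt ℝ q x := hq.isSymmSndFDerivAt (by simp)
  refine ⟨_, hαq.clm_comp hq'.hasFDerivAt, fun v w => ?_⟩
  simp [hsymm.eq v w]

end ExteriorDerivativeOnVectorSpace

section PullbackOneForm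

variable {F : Type*} [NormedAddCommGroup F] [NormedSpace ℝ F]
  {H : Type*} [TopologicalSpace H] {I : ModelWithCorners ℝ F H}
  {M : Type*} [TopologicalSpace M] [ChartedSpace H M]
  {X : Type*} [NormedAddCommGroup X] [NormedSpace ℝ X]

/-- The pullback `f^* α` of a one-form `α` along a map `f` from a vector space to a manifold. -/
def pullbackOneForm (α : ∀ m : M, TangentSpace I m →L[ℝ] ℝ) (f : X → M) (y : X) : X →L[ℝ] ℝ :=
  (α (f y)).comp (mfderiv 𝓘(ℝ, X) I f y)

variable {α : ∀ m : M, TangentSpace I m →L[ℝ] ℝ} {f : X → M} {x : X} {m : M}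

theorem pullbackOneForm_eq {A : X →L[ℝ] F} (hf : HasModelDerivAt 𝓘(ℝ, X) I f x A) (hm : f x = m) :
    pullbackOneForm α f x = (α m : F →L[ℝ] ℝ).comp A := by
  subst hm
  exact congrArg (fun B : X →L[ℝ] F => (α (f x) : F →L[ℝ] ℝ).comp B) hf.mfderiv_eq

theorem hasModelDerivAt_extChartAt_self [IsManifold I 1 M] (m : M) :
    HasModelDerivAt I 𝓘(ℝ, F) (extChartAt I m) m (.id ℝ F) :=
  (hasModelDerivAt_mfderiv (mdifferentiableAt_extChartAt (mem_chart_source H m))).congr_deriv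
    mfderiv_extChartAt_self

variable [I.Boundaryless]

theorem contMDiffAt_extChartAt_symm_of_mem {n : ℕ∞ω} [IsManifold I n M] (m : M) {u : F}
    (hu : u ∈ (extChartAt I m).target) : ContMDiffAt 𝓘(ℝ, F) I n (extChartAt I m).symm u :=
  (contMDiffOn_extChartAt_symm m).contMDiffAt ((isOpen_extChartAt_target m).mem_nhds hu)

theorem hasModelDerivAt_extChartAt_symm_self [IsManifold I 1 M] (m : M) :
    HasModelDerivAt 𝓘(ℝ, F) I (extChartAt I m).symm (extChartAt I m m) (.id ℝ F) := by
  refine (hasModelDerivAt_mfderiv ((contMDiffAt_extChartAt_symm_of_mem (n := 1) m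
    (mem_extChartAt_target m)).mdifferentiableAt one_ne_zero)).congr_deriv ?_
  have h := mfderivWithin_range_extChartAt_symm (I := I) (x := m)
  rw [I.range_eq_univ, mfderivWithin_univ] at h
  exact h

theorem eventually_pullbackOneForm_eq_comp_fderiv [IsManifold I 1 M]
    (hf : ContMDiffAt 𝓘(ℝ, X) I 1 f x) :
    ∀ᶠ y in 𝓝 x, pullbackOneForm α f y = (oneFormInChart I α (f x) (extChartAt I (f x) (f y))).comp
      (fderiv ℝ (fun y' => extChartAt I (f x) (f y')) y) := by
  have hsource : ∀ᶠ y in 𝓝 x, f y ∈ (extChartAt I (f x)).source :=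
    hf.continuousAt.eventually_mem (extChartAt_source_mem_nhds (I := I) (f x))
  have hq : ContDiffAt ℝ 1 (fun y => extChartAt I (f x) (f y)) x :=
    ((contMDiffAt_extChartAt (n := 1)).comp x hf).contDiffAt
  filter_upwards [hsource.eventually_nhds, hq.eventually (by simp)] with y hy hqy
  have hsymm := hasModelDerivAt_mfderiv ((contMDiffAt_extChartAt_symm_of_mem (I := I) (n := 1)
    (f x) ((extChartAt I (f x)).map_source hy.self_of_nhds)).mdifferentiableAt one_ne_zero)
  have hfy : HasModelDerivAt 𝓘(ℝ, X) I f y _ :=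
    (hsymm.comp (hasModelDerivAt_iff_hasFDerivAt.2
      (hqy.differentiableAt one_ne_zero).hasFDerivAt) rfl).congr_of_eventuallyEq
      (hy.mono fun y' hy' => ((extChartAt I (f x)).left_inv hy').symm)
  exact pullbackOneForm_eq hfy ((extChartAt I (f x)).left_inv hy.self_of_nhds).symm

theorem hasExteriorDerivAt_pullbackOneForm [IsManifold I 1 M] (hf : ContMDiffAt 𝓘(ℝ, X) I 2 f x)
    (hα : DifferentiableAt ℝ (oneFormInChart I α (f x)) (extChartAt I (f x) (f x))) :
    HasExteriorDerivAt (pullbackOneForm α f)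
      (fun v w => dOneForm I α (f x) (mfderiv 𝓘(ℝ, X) I f x v) (mfderiv 𝓘(ℝ, X) I f x w)) x := by
  have hf1 : ContMDiffAt 𝓘(ℝ, X) I 1 f x := hf.of_le one_le_two
  have hq : ContDiffAt ℝ 2 (fun y => extChartAt I (f x) (f y)) x :=
    ((contMDiffAt_extChartAt (n := 2)).comp x hf).contDiffAt
  have hq' : fderiv ℝ (fun y => extChartAt I (f x) (f y)) x
      = (mfderiv I 𝓘(ℝ, F) (extChartAt I (f x)) (f x)).comp (mfderiv 𝓘(ℝ, X) I f x) :=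
    (hasModelDerivAt_iff_hasFDerivAt.1
      ((hasModelDerivAt_mfderiv (mdifferentiableAt_extChartAt (mem_chart_source H (f x)))).comp
        (hasModelDerivAt_mfderiv (hf.mdifferentiableAt two_ne_zero)) rfl)).fderiv
  have h := (hasExteriorDerivAt_comp_fderiv (q := fun y => extChartAt I (f x) (f y)) hα
    hq).congr_of_eventuallyEq (eventually_pullbackOneForm_eq_comp_fderiv hf1)
  rw [hq'] at h
  exact h

end PullbackOneForm

section CanonicalForm

variable {E : Type*} [NormedAddCommGroup E] [NormedSpace ℝ E]
  {G : Type*} [TopologicalSpace G] [ChartedSpace E G] [Group G]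
  {X : Type*} [NormedAddCommGroup X] [NormedSpace ℝ X]

theorem contDiffAt_leftDeriv [LieGroup 𝓘(ℝ, E) 2 G] {g : X → G} {x : X}
    (hg : ContMDiffAt 𝓘(ℝ, X) 𝓘(ℝ, E) 2 g x) :
    ContDiffAt ℝ 1 (leftDeriv 𝓘(ℝ, X) 𝓘(ℝ, E) g) x := by
  have : LieGroup 𝓘(ℝ, E) 1 G := LieGroup.of_le one_le_two
  let χ := extChartAt 𝓘(ℝ, E) (1 : G)
  let K : X → X → E := fun y y' => χ ((g y)⁻¹ * g y')
  have hK : ContDiffAt ℝ 2 (Function.uncurry K) (x, x) := by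
    have hfst : ContMDiffAt 𝓘(ℝ, X × X) 𝓘(ℝ, E) 2 (fun p : X × X => g p.1) (x, x) :=
      ContMDiffAt.comp (x, x) hg contDiff_fst.contMDiff.contMDiffAt
    have hsnd : ContMDiffAt 𝓘(ℝ, X × X) 𝓘(ℝ, E) 2 (fun p : X × X => g p.2) (x, x) :=
      ContMDiffAt.comp (x, x) hg contDiff_snd.contMDiff.contMDiffAt
    exact (contMDiffAt_extChartAt.comp_of_eq (hfst.inv.mul hsnd) (inv_mul_cancel _)).contDiffAt
  have hK_deriv : ContDiffAt ℝ 1 (fun y => fderiv ℝ (K y) y) x :=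
    hK.fderiv (g := id) contDiffAt_id (by norm_num)
  refine hK_deriv.congr_of_eventuallyEq ?_
  filter_upwards [(contMDiffAt_iff_contMDiffAt_nhds (by simp)).1 hg] with y hy
  have hKy := (hasModelDerivAt_extChartAt_self (I := 𝓘(ℝ, E)) (1 : G)).comp
    (hasLeftDerivAt_leftDeriv (hy.mdifferentiableAt two_ne_zero)) (inv_mul_cancel _)
  rw [ContinuousLinearMap.id_comp, hasModelDerivAt_iff_hasFDerivAt] at hKy
  exact hKy.fderiv.symm

theorem pullbackOneForm_canonicalOneForm [LieGroup 𝓘(ℝ, E) 1 G] {f : X → G × (E →L[ℝ] ℝ)} {x : X}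
    (hf : MDifferentiableAt 𝓘(ℝ, X) (𝓘(ℝ, E).prod 𝓘(ℝ, E →L[ℝ] ℝ)) f x) :
    pullbackOneForm canonicalOneForm f x
      = (f x).2.comp (leftDeriv 𝓘(ℝ, X) 𝓘(ℝ, E) (fun y => (f y).1) x) := by
  have hleft : HasLeftDerivAt 𝓘(ℝ, X) 𝓘(ℝ, E) (fun y => (f y).1) x _ :=
    (hasModelDerivAt_mfderiv (mdifferentiableAt_mul_left (I := 𝓘(ℝ, E)))).comp
      ((hasModelDerivAt_mfderiv (mdifferentiableAt_fst (I := 𝓘(ℝ, E)))).comp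
        (hasModelDerivAt_mfderiv hf) rfl) rfl
  rw [hleft.leftDeriv_eq]
  rfl

theorem differentiableAt_oneFormInChart_canonicalOneForm [LieGroup 𝓘(ℝ, E) 2 G]
    (m : G × (E →L[ℝ] ℝ)) :
    DifferentiableAt ℝ (oneFormInChart (𝓘(ℝ, E).prod 𝓘(ℝ, E →L[ℝ] ℝ)) canonicalOneForm m)
      (extChartAt (𝓘(ℝ, E).prod 𝓘(ℝ, E →L[ℝ] ℝ)) m m) := by
  have : LieGroup 𝓘(ℝ, E) 1 G := LieGroup.of_le one_le_two
  let J := 𝓘(ℝ, E).prod 𝓘(ℝ, E →L[ℝ] ℝ)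
  have hsymm : ∀ u ∈ (extChartAt J m).target,
      ContMDiffAt 𝓘(ℝ, E × (E →L[ℝ] ℝ)) J 2 (extChartAt J m).symm u := fun u hu =>
    contMDiffAt_extChartAt_symm_of_mem m hu
  have hm := hsymm _ (mem_extChartAt_target m)
  refine ((hm.snd.contDiffAt.differentiableAt two_ne_zero).clm_comp
    ((contDiffAt_leftDeriv hm.fst).differentiableAt one_ne_zero)).congr_of_eventuallyEq ?_
  filter_upwards [(isOpen_extChartAt_target (I := J) m).mem_nhds (mem_extChartAt_target m)]
    with u hu
  exact pullbackOneForm_canonicalOneForm ((hsymm u hu).mdifferentiableAt two_ne_zero)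

end CanonicalForm

section LegendreTransform

variable {E : Type*} [NormedAddCommGroup E] [NormedSpace ℝ E]
  {G : Type*} [TopologicalSpace G] [ChartedSpace E G] [IsManifold 𝓘(ℝ, E) ∞ G] {ℓ : G × E → ℝ}

theorem contMDiff_projHp
    (hℓ : ContMDiff (𝓘(ℝ, E).prod 𝓘(ℝ, E)) 𝓘(ℝ, ℝ) ∞ ℓ) :
    ContMDiff (𝓘(ℝ, E).prod 𝓘(ℝ, E)) (𝓘(ℝ, E).prod 𝓘(ℝ, E →L[ℝ] ℝ)) ∞ (projHp ℓ) := by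
  intro x
  refine contMDiffAt_fst.prodMk ?_
  let χ := extChartAt 𝓘(ℝ, E) x.1
  let L : E × E → E → ℝ := fun p ζ => ℓ (χ.symm p.1, ζ)
  have hL : ContDiffAt ℝ ∞ (Function.uncurry L) ((χ x.1, x.2), x.2) := by
    have hχ : ContMDiffAt 𝓘(ℝ, (E × E) × E) 𝓘(ℝ, E) ∞ (fun q : (E × E) × E => χ.symm q.1.1)
        ((χ x.1, x.2), x.2) :=
      ContMDiffAt.comp (I' := 𝓘(ℝ, E)) ((χ x.1, x.2), x.2)
        (contMDiffAt_extChartAt_symm_of_mem x.1 (mem_extChartAt_target x.1))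
        contDiff_fst.fst.contMDiff.contMDiffAt
    exact (hℓ.contMDiffAt.comp ((χ x.1, x.2), x.2)
      (hχ.prodMk contDiff_snd.contMDiff.contMDiffAt)).contDiffAt
  have hL_deriv : ContDiffAt ℝ ∞ (fun p : E × E => fderiv ℝ (L p) p.2) (χ x.1, x.2) :=
    hL.fderiv contDiffAt_snd (by simp)
  have hchart : ContMDiffAt (𝓘(ℝ, E).prod 𝓘(ℝ, E)) 𝓘(ℝ, E × E) ∞
      (fun y : G × E => (χ y.1, y.2)) x :=
    (contMDiffAt_extChartAt.comp x contMDiffAt_fst).prodMk_space contMDiffAt_snd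
  refine (hL_deriv.contMDiffAt.comp x hchart).congr_of_eventuallyEq ?_
  filter_upwards [continuousAt_fst.eventually_mem
    (extChartAt_source_mem_nhds (I := 𝓘(ℝ, E)) x.1)] with y hy
  simp only [dXi, L, Function.comp_apply, χ.left_inv hy]

end LegendreTransform

section SymplecticForm

variable {E : Type*} [NormedAddCommGroup E] [NormedSpace ℝ E]
  {G : Type*} [TopologicalSpace G] [ChartedSpace E G] [Group G] [LieGroup 𝓘(ℝ, E) ∞ G]
  {X : Type*} [NormedAddCommGroup X] [NormedSpace ℝ X] {ℓ : G × E → ℝ}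

theorem hasExteriorDerivAt_pullback_projHp (hℓ : ContMDiff (𝓘(ℝ, E).prod 𝓘(ℝ, E)) 𝓘(ℝ, ℝ) ∞ ℓ)
    {f : X → G × E} {x : X} {z : G × E} {A : X →L[ℝ] E × E}
    (hf : ContMDiffAt 𝓘(ℝ, X) (𝓘(ℝ, E).prod 𝓘(ℝ, E)) 2 f x)
    (hA : HasModelDerivAt 𝓘(ℝ, X) (𝓘(ℝ, E).prod 𝓘(ℝ, E)) f x A) (hz : f x = z) :
    HasExteriorDerivAt (pullbackOneForm canonicalOneForm fun y => projHp ℓ (f y))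
      (fun v w => -omegaHp ℓ z (A v : E × E) (A w : E × E)) x := by
  subst hz
  have hproj : ContMDiffAt (𝓘(ℝ, E).prod 𝓘(ℝ, E)) (𝓘(ℝ, E).prod 𝓘(ℝ, E →L[ℝ] ℝ)) 2
      (projHp ℓ) (f x) := (contMDiff_projHp hℓ (f x)).of_le ENat.LEInfty.out
  have h := hasExteriorDerivAt_pullbackOneForm (hproj.comp x hf)
    (differentiableAt_oneFormInChart_canonicalOneForm _)
  have hderiv : mfderiv 𝓘(ℝ, X) (𝓘(ℝ, E).prod 𝓘(ℝ, E →L[ℝ] ℝ)) (projHp ℓ ∘ f) x = _ :=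
    ((hasModelDerivAt_mfderiv (hproj.mdifferentiableAt two_ne_zero)).comp hA rfl).mfderiv_eq
  rw [hderiv] at h
  simp only [omegaHp, canonicalTwoForm, neg_neg]
  exact h

theorem omegaHp_mfderiv_eq_of_eventually_hasFDerivAt
    (hℓ : ContMDiff (𝓘(ℝ, E).prod 𝓘(ℝ, E)) 𝓘(ℝ, ℝ) ∞ ℓ) {P : G × E → G × E} {x : G × E}
    (hP : ContMDiffAt (𝓘(ℝ, E).prod 𝓘(ℝ, E)) (𝓘(ℝ, E).prod 𝓘(ℝ, E)) 2 P x) {S : E × E → ℝ}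
    (hS : let κ := (extChartAt (𝓘(ℝ, E).prod 𝓘(ℝ, E)) x).symm
      ∀ᶠ y in 𝓝 (extChartAt (𝓘(ℝ, E).prod 𝓘(ℝ, E)) x x), HasFDerivAt S
        (pullbackOneForm canonicalOneForm (fun y' => projHp ℓ (P (κ y'))) y
          - pullbackOneForm canonicalOneForm (fun y' => projHp ℓ (κ y')) y) y)
    (v w : TangentSpace (𝓘(ℝ, E).prod 𝓘(ℝ, E)) x) :
    omegaHp ℓ (P x) (mfderiv (𝓘(ℝ, E).prod 𝓘(ℝ, E)) (𝓘(ℝ, E).prod 𝓘(ℝ, E)) P x v)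
      (mfderiv (𝓘(ℝ, E).prod 𝓘(ℝ, E)) (𝓘(ℝ, E).prod 𝓘(ℝ, E)) P x w) = omegaHp ℓ x v w := by
  let J := 𝓘(ℝ, E).prod 𝓘(ℝ, E)
  let κ := (extChartAt J x).symm
  have hκx : κ (extChartAt J x x) = x := extChartAt_to_inv x
  have hκ : ContMDiffAt 𝓘(ℝ, E × E) J 2 κ (extChartAt J x x) :=
    contMDiffAt_extChartAt_symm_of_mem x (mem_extChartAt_target x)
  have hκ' : HasModelDerivAt 𝓘(ℝ, E × E) J κ (extChartAt J x x) (.id ℝ (E × E)) :=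
    hasModelDerivAt_extChartAt_symm_self x
  have h₀ := hasExteriorDerivAt_pullback_projHp hℓ hκ hκ' hκx
  have h₁ := hasExteriorDerivAt_pullback_projHp hℓ (hP.comp_of_eq hκ hκx)
    ((hasModelDerivAt_mfderiv (hP.mdifferentiableAt two_ne_zero)).comp hκ' hκx)
    (congrArg P hκx)
  exact neg_injective (h₁.eq_of_eventually_hasFDerivAt_sub h₀ hS v w)

end SymplecticForm

section DiscreteFlow

variable {E : Type*} [NormedAddCommGroup E] [NormedSpace ℝ E]
  {G : Type*} {ℓ : G × E → ℝ}

theorem projHp_graphChart (z : admissibleSpace ℓ) :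
    projHp ℓ (graphChart ℓ z) = (z.1.1, z.1.2.2) :=
  Prod.ext rfl z.2.symm

variable [TopologicalSpace G] [ChartedSpace E G]

theorem isOpen_preimage_graphChart_symm [IsManifold 𝓘(ℝ, E) ∞ G]
    (hℓ : ContMDiff (𝓘(ℝ, E).prod 𝓘(ℝ, E)) 𝓘(ℝ, ℝ) ∞ ℓ) {U : Set (admissibleSpace ℓ)}
    (hU : IsOpen U) : IsOpen ((graphChart ℓ).symm ⁻¹' U) :=
  hU.preimage ((continuous_fst.prodMk (continuous_snd.prodMk
    (contMDiff_projHp hℓ).continuous.snd)).subtype_mk _)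

variable [Group G] [LieGroup 𝓘(ℝ, E) ∞ G] {τ : OpenPartialHomeomorph E G} {h : ℝ} {s : ℕ}
  {a : Fin s → Fin s → ℝ} {b : Fin s → ℝ} {U : Set (admissibleSpace ℓ)}
  {F : admissibleSpace ℓ → admissibleSpace ℓ}

namespace IsDiscreteFlow

theorem exists_hasFDerivAt_pullbackOneForm_sub (hF : IsDiscreteFlow τ a b h ℓ U F)
    (hτ : IsCanonicalChart τ) (hℓ : ContMDiff (𝓘(ℝ, E).prod 𝓘(ℝ, E)) 𝓘(ℝ, ℝ) ∞ ℓ) (hh : h ≠ 0)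
    (hb : ∀ i, b i ≠ 0) (hU : IsOpen U) (X : Type*) [NormedAddCommGroup X] [NormedSpace ℝ X] :
    ∃ S : G × E → ℝ, ∀ (κ : X → G × E) (y : X),
      MDifferentiableAt 𝓘(ℝ, X) (𝓘(ℝ, E).prod 𝓘(ℝ, E)) κ y → (graphChart ℓ).symm (κ y) ∈ U →
      HasFDerivAt (fun y' => S (κ y'))
        (pullbackOneForm canonicalOneForm (fun y' => projHp ℓ (inGraphChart ℓ F (κ y'))) y
          - pullbackOneForm canonicalOneForm (fun y' => projHp ℓ (κ y')) y) y := by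
  obtain ⟨c, ξ, M, hXi, hsol⟩ := hF.scheme
  refine ⟨fun x => (c ((graphChart ℓ).symm x)).lagrangianSum τ b h ℓ, fun κ y hκ hy => ?_⟩
  have hnhds := (isOpen_preimage_graphChart_symm hℓ hU).mem_nhds hy
  have hnear : ∀ᶠ y' in 𝓝 y, (graphChart ℓ).symm (κ y') ∈ U := hκ.continuousAt.eventually_mem hnhds
  have hproj : MDifferentiable (𝓘(ℝ, E).prod 𝓘(ℝ, E)) (𝓘(ℝ, E).prod 𝓘(ℝ, E →L[ℝ] ℝ)) (projHp ℓ) :=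
    (contMDiff_projHp hℓ).mdifferentiable (by simp)
  have hFκ : MDifferentiableAt 𝓘(ℝ, X) (𝓘(ℝ, E).prod 𝓘(ℝ, E))
      (fun y' => inGraphChart ℓ F (κ y')) y :=
    ((hF.smooth.contMDiffAt hnhds).mdifferentiableAt (by simp)).comp y hκ
  let z : X → admissibleSpace ℓ := fun y' => (graphChart ℓ).symm (κ y')
  let A : Fin 2 → X →L[ℝ] E :=
    ![leftDeriv 𝓘(ℝ, X) 𝓘(ℝ, E) (fun y' => (κ y').1) y,
      leftDeriv 𝓘(ℝ, X) 𝓘(ℝ, E) (fun y' => (inGraphChart ℓ F (κ y')).1) y]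
  have hA : ∀ k, HasLeftDerivAt 𝓘(ℝ, X) 𝓘(ℝ, E) (fun y' => (c (z y')).g k) y (A k) :=
    Fin.forall_fin_two.2
      ⟨(hasLeftDerivAt_leftDeriv hκ.fst).congr_of_eventuallyEq
        (hnear.mono fun y' hy' => (hsol _ hy').2.2.2.1),
      (hasLeftDerivAt_leftDeriv hFκ.fst).congr_of_eventuallyEq
        (hnear.mono fun y' hy' => (hsol _ hy').2.2.2.2.2.1)⟩
  have hXi_diff : ∀ i, DifferentiableAt ℝ (fun y' => (c (z y')).Xi 0 i) y := fun i =>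
    ((((hXi i).contMDiffAt hnhds).mdifferentiableAt (by simp)).comp y hκ).differentiableAt
  obtain ⟨hchart, -, -, -, hp₀, -, hp₁⟩ := hsol _ hy
  have hsum := DiscreteCurve.hasFDerivAt_lagrangianSum (c := fun y' => c (z y'))
    (ξ := fun y' => ξ (z y')) (M := fun y' => M (z y')) hτ
    (hℓ.mdifferentiable (by simp)) hh hb hchart (hnear.mono fun y' hy' => (hsol _ hy').2.2.1)
    hA (Fin.forall_fin_one.2 hXi_diff)
  have hend_momentum : (projHp ℓ (inGraphChart ℓ F (κ y))).2 = (F (z y)).1.2.2 :=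
    congrArg Prod.snd (projHp_graphChart (F (z y)))
  have hend_form := pullbackOneForm_canonicalOneForm ((hproj _).comp y hFκ)
  have hstart_form := pullbackOneForm_canonicalOneForm ((hproj _).comp y hκ)
  refine hsum.congr_fderiv (congrArg₂ _ ?_ ?_)
  · refine (hend_form.trans ?_).symm
    exact congrArg (fun p : E →L[ℝ] ℝ => p.comp (A 1)) (hend_momentum.trans hp₁.symm)
  · refine (hstart_form.trans ?_).symm
    exact congrArg (fun p : E →L[ℝ] ℝ => p.comp (A 0)) hp₀.symm

theorem preservesOmegaHp (hF : IsDiscreteFlow τ a b h ℓ U F) (hτ : IsCanonicalChart τ)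
    (hℓ : ContMDiff (𝓘(ℝ, E).prod 𝓘(ℝ, E)) 𝓘(ℝ, ℝ) ∞ ℓ) (hh : h ≠ 0) (hb : ∀ i, b i ≠ 0)
    (hU : IsOpen U) : PreservesOmegaHp ℓ U F := by
  obtain ⟨S, hS⟩ := hF.exists_hasFDerivAt_pullbackOneForm_sub hτ hℓ hh hb hU (E × E)
  intro x hx v w _
  have hV := isOpen_preimage_graphChart_symm hℓ hU
  let J := 𝓘(ℝ, E).prod 𝓘(ℝ, E)
  have htarget := extChartAt_target_mem_nhds (I := J) x
  have hκ : ∀ y ∈ (extChartAt J x).target,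
      MDifferentiableAt 𝓘(ℝ, E × E) J (extChartAt J x).symm y := fun y hy =>
    (contMDiffAt_extChartAt_symm_of_mem (n := 1) x hy).mdifferentiableAt one_ne_zero
  have hmem : ∀ᶠ y in 𝓝 (extChartAt J x x), (extChartAt J x).symm y ∈ (graphChart ℓ).symm ⁻¹' U :=
    (continuousAt_extChartAt_symm x).eventually_mem
      (hV.mem_nhds ((extChartAt_to_inv (I := J) x).symm ▸ hx))
  refine omegaHp_mfderiv_eq_of_eventually_hasFDerivAt hℓ
    (S := fun y => S ((extChartAt J x).symm y))
    ((hF.smooth.contMDiffAt (hV.mem_nhds hx)).of_le ENat.LEInfty.out) ?_ v w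
  filter_upwards [htarget, hmem] with y hy hyU
  exact hS _ y (hκ y hy) hyU

end IsDiscreteFlow

end DiscreteFlow

end LieVPRK

end

theorem mainTheorem3_general
    {E : Type*} [NormedAddCommGroup E] [NormedSpace ℝ E]
    {G : Type*} [TopologicalSpace G] [ChartedSpace E G] [Group G] [LieGroup 𝓘(ℝ, E) ∞ G]
    (τ : OpenPartialHomeomorph E G) (hτ : LieVPRK.IsCanonicalChart τ)
    (ℓ : G × E → ℝ) (hℓ : ContMDiff (𝓘(ℝ, E).prod 𝓘(ℝ, E)) 𝓘(ℝ, ℝ) ∞ ℓ)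
    (s : ℕ) (a : Fin s → Fin s → ℝ) (b : Fin s → ℝ) (hb : ∀ i, b i ≠ 0)
    (h : ℝ) (hh : h ≠ 0) :
    (∀ (N : ℕ), 0 < N → ∀ (g₁ g₂ : G),
      ∀ c ∈ LieVPRK.DiscreteCurve.pathSpace E N s g₁ g₂, c.InChart τ h →
      ∀ ξ₀ : E, h • ξ₀ ∈ τ.source →
        (c.IsCritical τ a b h ℓ g₁ g₂ ↔
          (∃! ν : E →L[ℝ] ℝ, (c.withMuZero ν).SatisfiesVPRK τ a b h ℓ ξ₀) ∧
            ∀ (k : Fin N) (i : Fin s),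
              c.muStage k.castSucc i = -((h * b i) • c.force τ h ℓ k i))) ∧
    (∀ (U : Set (LieVPRK.admissibleSpace ℓ)) (F : LieVPRK.admissibleSpace ℓ →
        LieVPRK.admissibleSpace ℓ), IsOpen U → LieVPRK.IsDiscreteFlow τ a b h ℓ U F →
      LieVPRK.PreservesOmegaHp ℓ U F) := by
  have hℓ_diff := hℓ.mdifferentiable (by simp)
  refine ⟨fun N hN g₁ g₂ c hc hchart ξ₀ hξ₀ => ?_, fun U F hU hF =>
    hF.preservesOmegaHp hτ hℓ hh hb hU⟩
  calc c.IsCritical τ a b h ℓ g₁ g₂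
      ↔ _ := LieVPRK.DiscreteCurve.isCritical_iff_exists_satisfiesHamiltonPontryagin hτ hℓ_diff
        hh hc hchart
    _ ↔ _ :=
      (LieVPRK.DiscreteCurve.existsUnique_satisfiesVPRK_and_muStage_iff hτ hh hb hN hchart
        hξ₀).symm

theorem mainTheorem3
    {E : Type*} [NormedAddCommGroup E] [NormedSpace ℝ E] [FiniteDimensional ℝ E]
    {G : Type*} [TopologicalSpace G] [ChartedSpace E G] [Group G] [LieGroup 𝓘(ℝ, E) ∞ G]
    (τ : OpenPartialHomeomorph E G) (hτ : LieVPRK.IsCanonicalChart τ)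
    (ℓ : G × E → ℝ) (hℓ : ContMDiff (𝓘(ℝ, E).prod 𝓘(ℝ, E)) 𝓘(ℝ, ℝ) ∞ ℓ)
    (s : ℕ) (a : Fin s → Fin s → ℝ) (b : Fin s → ℝ) (hb : ∀ i, b i ≠ 0)
    (h : ℝ) (hh : 0 < h) :
    (∀ (N : ℕ), 0 < N → ∀ (g₁ g₂ : G),
      ∀ c ∈ LieVPRK.DiscreteCurve.pathSpace E N s g₁ g₂, c.InChart τ h →
      ∀ ξ₀ : E, h • ξ₀ ∈ τ.source →
        (c.IsCritical τ a b h ℓ g₁ g₂ ↔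
          (∃! ν : E →L[ℝ] ℝ, (c.withMuZero ν).SatisfiesVPRK τ a b h ℓ ξ₀) ∧
            ∀ (k : Fin N) (i : Fin s),
              c.muStage k.castSucc i = -((h * b i) • c.force τ h ℓ k i))) ∧
    (∀ (U : Set (LieVPRK.admissibleSpace ℓ)) (F : LieVPRK.admissibleSpace ℓ →
        LieVPRK.admissibleSpace ℓ), IsOpen U → LieVPRK.IsDiscreteFlow τ a b h ℓ U F →
      LieVPRK.PreservesOmegaHp ℓ U F) := by
  exact mainTheorem3_general τ hτ ℓ hℓ s a b hb h hh.ne'
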